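/- Let $S^1=\mathbb R/2\pi\mathbb Z$, let $E$ be a finite-dimensional real inner product space (for example $\mathbb R$ or $\mathbb R^d$), and let $k,\ell,n_t,n_\theta\ge 0$ be integers with $n_t\ge k$ and $n_\theta\ge \ell$. Let $$H^{k,\ell}([0,1]\times S^1;E)=\{f\in L^2([0,1]\times S^1;E):\ \text{the weak derivatives } f^{(k,0)},f^{(0,\ell)},f^{(k,\ell)} \text{ exist in } L^2([0,1]\times S^1;E)\},$$ where $f^{(a,b)}=\partial_t^a\partial_\theta^b f$, be the mixed Sobolev space with inner product $$\langle f,g\rangle_{H^{k,\ell}}=\langle f,g\rangle_{L^2}+\langle f^{(k,0)},g^{(k,0)}\rangle_{L^2}+\langle f^{(0,\ell)},g^{(0,\ell)}\rangle_{L^2}+\langle f^{(k,\ell)},g^{(k,\ell)}\rangle_{L^2}.$$ For $N_t,N_\theta\ge 1$ let $B_i$, $i=1,\dots,N_t+n_t$, be the normalized B-splines of degree $n_t$ on $[0,1]$ for the knots $$t_i=\begin{cases}0,&0\le i<n_t,\\ (i-n_t)/N_t,& n_t\le i<n_t+N_t,\\ 1,& n_t+N_t\le i\le 2n_t+N_t,\end{cases}$$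 and let $C_j$, $j=1,\dots,N_\theta$, be the $2\pi$-periodic normalized B-splines of degree $n_\theta$ for the uniform knots $\theta_j=2\pi (j-n_\theta)/N_\theta$. Let $\mathcal S^{n_t,n_\theta}_{N_t,N_\theta}$ be the orthogonal projection of $H^{k,\ell}([0,1]\times S^1;E)$ onto the space of tensor product splines $\sum_{i,j}c_{i,j}\,B_i(t)\,C_j(\theta)$, $c_{i,j}\in E$. Then for every $c\in H^{k,\ell}([0,1]\times S^1;E)$, $$\lim_{N_t,N_\theta\to\infty}\big\|c-\mathcal S^{n_t,n_\theta}_{N_t,N_\theta}c\big\|_{H^{k,\ell}([0,1]\times S^1;E)}=0,$$ where $N_t$ and $N_\theta$ tend to infinity jointly and independently of each other. -/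

import Mathlib

open MeasureTheory Set Filter Topology
open scoped ContDiff ENNReal

noncomputable section

/-! ### The cylinder `[0,1] × S¹`

The circle `S¹ = ℝ / 2πℤ` is represented by its fundamental domain `(0, 2π]`; periodicity enters
through the test functions below, which are `2π`-periodic and unrestricted in the angle. -/

/-- Lebesgue measure on `[0,1] × S¹`. -/
def cylMeasure : Measure (ℝ × ℝ) :=
  (volume.restrict (Icc (0 : ℝ) 1)).prod (volume.restrict (Ioc (0 : ℝ) (2 * Real.pi)))

instance : IsFiniteMeasure cylMeasure := by
  unfold cylMeasure; infer_instance

/-- `L²([0,1] × S¹; E)`. -/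
abbrev CylL2 (E : Type*) [NormedAddCommGroup E] : Type _ := Lp E 2 cylMeasure

/-! ### Weak derivatives -/

/-- The classical partial derivative `∂φ/∂t`. -/
def partialT (φ : ℝ × ℝ → ℝ) (p : ℝ × ℝ) : ℝ := fderiv ℝ φ p (1, 0)

/-- The classical partial derivative `∂φ/∂θ`. -/
def partialTheta (φ : ℝ × ℝ → ℝ) (p : ℝ × ℝ) : ℝ := fderiv ℝ φ p (0, 1)

/-- The classical mixed partial derivative `∂ₜᵃ ∂_θᵇ φ`. -/
def mixedPartial (a b : ℕ) (φ : ℝ × ℝ → ℝ) : ℝ × ℝ → ℝ := partialT^[a] (partialTheta^[b] φ)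

/-- Smooth functions on `(0,1) × S¹` with compact support: smooth functions of `(t, θ)` that are
`2π`-periodic in `θ` and supported in `[ε, 1 - ε] × ℝ` for some `ε > 0`. -/
structure IsTestFunction (φ : ℝ × ℝ → ℝ) : Prop where
  smooth : ContDiff ℝ ∞ φ
  periodic : ∀ t θ : ℝ, φ (t, θ + 2 * Real.pi) = φ (t, θ)
  compactSupport : ∃ ε > 0, ∀ t θ : ℝ, φ (t, θ) ≠ 0 → ε ≤ t ∧ t ≤ 1 - ε

section

variable {E : Type*} [NormedAddCommGroup E] [InnerProductSpace ℝ E]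

/-- `g` is the weak derivative `f^{(a,b)} = ∂ₜᵃ ∂_θᵇ f` of `f` on `[0,1] × S¹`. -/
def HasWeakDeriv (a b : ℕ) (f g : CylL2 E) : Prop :=
  ∀ φ : ℝ × ℝ → ℝ, IsTestFunction φ →
    ∫ p, mixedPartial a b φ p • f p ∂cylMeasure =
      (-1 : ℝ) ^ (a + b) • ∫ p, φ p • g p ∂cylMeasure

theorem contDiff_partialT {φ : ℝ × ℝ → ℝ} (h : ContDiff ℝ ∞ φ) : ContDiff ℝ ∞ (partialT φ) :=
  (h.fderiv_right (m := ∞) (by simp)).clm_apply contDiff_const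

theorem contDiff_partialTheta {φ : ℝ × ℝ → ℝ} (h : ContDiff ℝ ∞ φ) :
    ContDiff ℝ ∞ (partialTheta φ) :=
  (h.fderiv_right (m := ∞) (by simp)).clm_apply contDiff_const

theorem contDiff_mixedPartial (a b : ℕ) {φ : ℝ × ℝ → ℝ} (h : ContDiff ℝ ∞ φ) :
    ContDiff ℝ ∞ (mixedPartial a b φ) := by
  have h1 : ContDiff ℝ ∞ (partialTheta^[b] φ) := by
    induction b with
    | zero => exact h
    | succ b ih => rw [Function.iterate_succ_apply']; exact contDiff_partialTheta ih
  unfold mixedPartial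
  induction a with
  | zero => exact h1
  | succ a ih => rw [Function.iterate_succ_apply']; exact contDiff_partialT ih

theorem memLp_cyl_of_continuous {φ : ℝ × ℝ → ℝ} (h : Continuous φ) :
    MemLp φ 2 cylMeasure := by
  have hc : IsCompact (Icc (0 : ℝ) 1 ×ˢ Icc (0 : ℝ) (2 * Real.pi)) :=
    isCompact_Icc.prod isCompact_Icc
  obtain ⟨C, hC⟩ := hc.exists_bound_of_continuousOn h.continuousOn
  refine MemLp.of_bound h.aestronglyMeasurable C ?_
  unfold cylMeasure
  rw [Measure.prod_restrict]
  refine (ae_restrict_iff' (measurableSet_Icc.prod measurableSet_Ioc)).2 (ae_of_all _ ?_)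
  rintro ⟨t, θ⟩ ⟨h1, h2⟩
  exact hC _ ⟨h1, Ioc_subset_Icc_self h2⟩

/-- Integration against a continuous weight, as a continuous linear functional on `L²`. -/
def cylPairing [CompleteSpace E] (φ : ℝ × ℝ → ℝ) (h : Continuous φ) : CylL2 E →L[ℝ] E :=
  (ContinuousLinearMap.lsmul ℝ ℝ).lpPairing cylMeasure 2 2
    ((memLp_cyl_of_continuous h).toLp φ)

theorem cylPairing_apply [CompleteSpace E] (φ : ℝ × ℝ → ℝ) (h : Continuous φ) (f : CylL2 E) :
    cylPairing φ h f = ∫ p, φ p • f p ∂cylMeasure := by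
  unfold cylPairing
  rw [ContinuousLinearMap.lpPairing_eq_integral]
  refine integral_congr_ae ?_
  filter_upwards [(memLp_cyl_of_continuous h).coeFn_toLp] with p hp
  simp [hp]

/-- The defect in the definition of the weak derivative, as a continuous linear functional. -/
theorem hasWeakDeriv_iff [CompleteSpace E] (a b : ℕ) (f g : CylL2 E) :
    HasWeakDeriv a b f g ↔ ∀ (φ : ℝ × ℝ → ℝ) (h : IsTestFunction φ),
      cylPairing (mixedPartial a b φ) (contDiff_mixedPartial a b h.smooth).continuous f =
        (-1 : ℝ) ^ (a + b) • cylPairing φ h.smooth.continuous g := by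
  simp only [HasWeakDeriv, cylPairing_apply]

end

/-! ### Sobolev spaces of mixed order -/

section

variable (E : Type*) [NormedAddCommGroup E] [InnerProductSpace ℝ E] [FiniteDimensional ℝ E]

/-- The mixed Sobolev space `H^{k,ℓ}([0,1] × S¹; E)`. An element is a function `f ∈ L²` (the
component `u (0, 0)`) together with its weak derivatives
`f^{(k,0)}`, `f^{(0,ℓ)}`, `f^{(k,ℓ)} ∈ L²` (the components `(1, 0)`, `(0, 1)`, `(1, 1)`), which are
determined by `f`. The inner product inherited from the `ℓ²`-sum is
`⟪f,g⟫ + ⟪f^{(k,0)},g^{(k,0)}⟫ + ⟪f^{(0,ℓ)},g^{(0,ℓ)}⟫ + ⟪f^{(k,ℓ)},g^{(k,ℓ)}⟫`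
(inner products of `L²`). -/
def MixedSobolev (k ℓ : ℕ) : Submodule ℝ (PiLp 2 fun _ : Fin 2 × Fin 2 => CylL2 E) where
  carrier := {u | ∀ a b : Fin 2, HasWeakDeriv ((a : ℕ) * k) ((b : ℕ) * ℓ) (u (0, 0)) (u (a, b))}
  zero_mem' := by
    have : CompleteSpace E := FiniteDimensional.complete ℝ E
    intro a b
    rw [hasWeakDeriv_iff]
    intro φ h
    simp
  add_mem' := by
    have : CompleteSpace E := FiniteDimensional.complete ℝ E
    intro u v hu hv a b
    have hu := hu a b
    have hv := hv a b
    rw [hasWeakDeriv_iff] at *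
    intro φ h
    simp only [PiLp.add_apply, map_add, smul_add, hu φ h, hv φ h]
  smul_mem' := by
    have : CompleteSpace E := FiniteDimensional.complete ℝ E
    intro r u hu a b
    have hu := hu a b
    rw [hasWeakDeriv_iff] at *
    intro φ h
    simp only [PiLp.smul_apply, map_smul, hu φ h]
    rw [smul_comm]

theorem isClosed_mixedSobolev (k ℓ : ℕ) :
    IsClosed (MixedSobolev E k ℓ : Set (PiLp 2 fun _ : Fin 2 × Fin 2 => CylL2 E)) := by
  have : CompleteSpace E := FiniteDimensional.complete ℝ E
  have : (MixedSobolev E k ℓ : Set (PiLp 2 fun _ : Fin 2 × Fin 2 => CylL2 E)) =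
      ⋂ (a : Fin 2) (b : Fin 2) (φ : ℝ × ℝ → ℝ) (h : IsTestFunction φ),
        {u | cylPairing (mixedPartial ((a : ℕ) * k) ((b : ℕ) * ℓ) φ)
            (contDiff_mixedPartial _ _ h.smooth).continuous (u (0, 0)) =
          (-1 : ℝ) ^ ((a : ℕ) * k + (b : ℕ) * ℓ) • cylPairing φ h.smooth.continuous (u (a, b))} := by
    ext u
    simp only [mem_iInter, mem_ofPred_eq, ← hasWeakDeriv_iff]
    rfl
  rw [this]
  refine isClosed_iInter fun a => isClosed_iInter fun b => isClosed_iInter fun φ =>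
    isClosed_iInter fun h => isClosed_eq ?_ ?_
  · fun_prop
  · fun_prop

instance completeSpace_mixedSobolev (k ℓ : ℕ) : CompleteSpace (MixedSobolev E k ℓ) :=
  have : CompleteSpace E := FiniteDimensional.complete ℝ E
  (isClosed_mixedSobolev E k ℓ).completeSpace_coe

/-- The inclusion `H^{k,ℓ} → L²`, sending an element to the underlying function. -/
def MixedSobolev.toL2 (k ℓ : ℕ) : MixedSobolev E k ℓ →L[ℝ] CylL2 E :=
  (PiLp.proj 2 (fun _ : Fin 2 × Fin 2 => CylL2 E) (0, 0)).comp (MixedSobolev E k ℓ).subtypeL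

end

/-! ### B-splines -/

/-- The normalized B-splines of degree `n` for the knot sequence `τ`, by the Cox–de Boor recursion
with the usual convention `x / 0 = 0`; the `i`-th one is supported in `[τ i, τ (i + n + 1)]`. -/
def bspline (τ : ℕ → ℝ) : ℕ → ℕ → ℝ → ℝ
  | 0, i, x => if τ i ≤ x ∧ x < τ (i + 1) then 1 else 0
  | n + 1, i, x =>
      (x - τ i) / (τ (i + n + 1) - τ i) * bspline τ n i x +
        (τ (i + n + 2) - x) / (τ (i + n + 2) - τ (i + 1)) * bspline τ n (i + 1) x

/-- The uniform knots on `[0,1]` with `N` subintervals and full multiplicity at the boundary;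
only `i = 0, …, 2n + N` are used. -/
def knotT (n N i : ℕ) : ℝ :=
  if i < n then 0 else if i < n + N then ((i : ℝ) - n) / N else 1

/-- The uniform knots on `ℝ` with `N` subintervals per period `2π`. -/
def knotTheta (n N j : ℕ) : ℝ := 2 * Real.pi * ((j : ℝ) - n) / N

/-- The B-splines `B_i` of degree `n` on `[0,1]`; the knots `0, …, 2n + N` carry exactly those
with `i = 0, …, n + N - 1`. -/
def splineB (n N i : ℕ) (t : ℝ) : ℝ := bspline (knotT n N) n i t

/-- The periodic B-splines `C_j` of degree `n` on the circle, `j = 0, …, N - 1`: the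
`2π`-periodization (a finite sum at every point) of the B-spline with knots
`θ_j, …, θ_{j + n + 1}`. -/
def splineC (n N j : ℕ) (θ : ℝ) : ℝ :=
  ∑ᶠ m : ℤ, bspline (knotTheta n N) n j (θ + 2 * Real.pi * m)

/-- The tensor product spline `∑ᵢ ∑ⱼ c_{i,j} B_i(t) C_j(θ)` with control points `c_{i,j} ∈ E`. -/
def tensorSpline {E : Type*} [NormedAddCommGroup E] [InnerProductSpace ℝ E]
    (nt nθ Nt Nθ : ℕ) (c : Fin (nt + Nt) → Fin Nθ → E) (p : ℝ × ℝ) : E :=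
  ∑ i : Fin (nt + Nt), ∑ j : Fin Nθ, (splineB nt Nt i p.1 * splineC nθ Nθ j p.2) • c i j

section

variable (E : Type*) [NormedAddCommGroup E] [InnerProductSpace ℝ E]

/-- The span of the tensor product splines `B_i ⊗ C_j`, with coefficients in `E`, in `L²`. -/
def splineL2 (nt nθ Nt Nθ : ℕ) : Submodule ℝ (CylL2 E) where
  carrier := {f | ∃ c, f =ᵐ[cylMeasure] tensorSpline nt nθ Nt Nθ c}
  zero_mem' := by
    refine ⟨0, ?_⟩
    filter_upwards [Lp.coeFn_zero E 2 cylMeasure] with p hp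
    rw [hp]
    simp [tensorSpline]
  add_mem' := by
    rintro f g ⟨c, hc⟩ ⟨d, hd⟩
    refine ⟨c + d, ?_⟩
    filter_upwards [Lp.coeFn_add f g, hc, hd] with p hp h1 h2
    rw [hp, Pi.add_apply, h1, h2]
    simp [tensorSpline, Finset.sum_add_distrib]
  smul_mem' := by
    rintro r f ⟨c, hc⟩
    refine ⟨r • c, ?_⟩
    filter_upwards [Lp.coeFn_smul r f, hc] with p hp h1
    rw [hp, Pi.smul_apply, h1]
    simp [tensorSpline, Finset.smul_sum, smul_comm r]

variable [FiniteDimensional ℝ E]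

instance finiteDimensional_splineL2 (nt nθ Nt Nθ : ℕ) :
    FiniteDimensional ℝ (splineL2 E nt nθ Nt Nθ) := by
  have hadd : ∀ c d : Fin (nt + Nt) → Fin Nθ → E, tensorSpline nt nθ Nt Nθ (c + d) =
      tensorSpline nt nθ Nt Nθ c + tensorSpline nt nθ Nt Nθ d := by
    intro c d; ext p; simp [tensorSpline, Finset.sum_add_distrib]
  have hsmul : ∀ (r : ℝ) (c : Fin (nt + Nt) → Fin Nθ → E), tensorSpline nt nθ Nt Nθ (r • c) =
      r • tensorSpline nt nθ Nt Nθ c := by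
    intro r c; ext p; simp [tensorSpline, Finset.smul_sum, smul_comm r]
  let P : Submodule ℝ (Fin (nt + Nt) → Fin Nθ → E) :=
    { carrier := {c | MemLp (tensorSpline nt nθ Nt Nθ c) 2 cylMeasure}
      zero_mem' := by
        have : tensorSpline nt nθ Nt Nθ (0 : Fin (nt + Nt) → Fin Nθ → E) = fun _ => 0 := by
          ext p; simp [tensorSpline]
        simp [this]
      add_mem' := fun {c d} hc hd => by
        simp only [mem_ofPred_eq, hadd] at *; exact hc.add hd
      smul_mem' := fun r {c} hc => by
        simp only [mem_ofPred_eq, hsmul] at *; exact hc.const_smul r }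
  let T : P →ₗ[ℝ] CylL2 E :=
    { toFun := fun c => MemLp.toLp (tensorSpline nt nθ Nt Nθ c.1) c.2
      map_add' := fun c d => by
        rw [← MemLp.toLp_add]; exact MemLp.toLp_congr _ _ (by simp [hadd])
      map_smul' := fun r c => by
        rw [RingHom.id_apply, ← MemLp.toLp_const_smul]
        exact MemLp.toLp_congr _ _ (by simp [hsmul]) }
  have hle : splineL2 E nt nθ Nt Nθ ≤ LinearMap.range T := by
    rintro f ⟨c, hc⟩
    have hm : MemLp (tensorSpline nt nθ Nt Nθ c) 2 cylMeasure := (Lp.memLp f).ae_eq hc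
    exact ⟨⟨c, hm⟩, Lp.ext ((MemLp.coeFn_toLp hm).trans hc.symm)⟩
  exact Submodule.finiteDimensional_of_le hle

/-- The span of the tensor product splines as a subspace of `H^{k,ℓ}([0,1] × S¹; E)`: the elements
of `H^{k,ℓ}` whose underlying function is a tensor product spline. (For `k ≤ nt` and `ℓ ≤ nθ` every
tensor product spline lies in `H^{k,ℓ}`, so nothing is lost.) -/
def splineSpace (k ℓ nt nθ Nt Nθ : ℕ) : Submodule ℝ (MixedSobolev E k ℓ) :=
  (splineL2 E nt nθ Nt Nθ).comap (MixedSobolev.toL2 E k ℓ).toLinearMap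

instance completeSpace_splineSpace (k ℓ nt nθ Nt Nθ : ℕ) :
    CompleteSpace (splineSpace E k ℓ nt nθ Nt Nθ) := by
  have h : IsClosed (splineSpace E k ℓ nt nθ Nt Nθ : Set (MixedSobolev E k ℓ)) :=
    (Submodule.closed_of_finiteDimensional (splineL2 E nt nθ Nt Nθ)).preimage
      (MixedSobolev.toL2 E k ℓ).continuous
  exact h.completeSpace_coe

/-- The spline approximation operator: the orthogonal projection of `H^{k,ℓ}([0,1] × S¹; E)` onto
the span of the tensor product splines `B_i ⊗ C_j` of degrees `nt`, `nθ`. -/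
def splineProj (k ℓ nt nθ Nt Nθ : ℕ) : MixedSobolev E k ℓ →L[ℝ] MixedSobolev E k ℓ :=
  (splineSpace E k ℓ nt nθ Nt Nθ).starProjection

end

end

/-!
The operators `1 - splineProj` are contractions, so the convergence has to be checked only on a set
whose span is dense in `H^{k,ℓ}` (`tendsto_splineProj_of_dense`). The set used here consists of the
products `q(t) cos (m θ + c) e` with a polynomial `q` and a vector `e` (`polyTrigTensors`).

**Approximation of the products.** By the minimality of the projection it suffices to exhibit good
splines. On a uniform grid of step `h` take the quasi-interpolant `∑ⱼ f(h j) B(x / h - j)`, where `B`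
is the cardinal B-spline of degree `n`. The derivative of `B` is a difference of B-splines of lower
degree, so the `r`-th derivative of the quasi-interpolant, `r ≤ n`, is the quasi-interpolant of
degree `n - r` of an `r`-th difference quotient of `f`, whose values are values of `f⁽ʳ⁾` nearby. The
B-splines are nonnegative, local and sum to `1`, hence these derivatives converge to `f⁽ʳ⁾` uniformly
on bounded sets (`DerivChain.tendsto_splineChain`), and products of them converge in `H^{k,ℓ}`
(`tendsto_splineProj_tensor`). For periodic `f` the quasi-interpolant is a combination of the `C_j`
(`quasiInterp_eq_splineC`). Its restriction to `[0,1)` is a combination of the `B_i`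
(`exists_quasiInterp_eq_splineB`), although these have multiple knots at the ends: the cardinal
B-spline is a combination of truncated powers at grid points, and Marsden's identity, truncated at a
knot, expresses those through the `B_i`.

**Density.** Let `u` be orthogonal to all the products. Integrating against `cos (m θ + c)` in the
angle turns a component of `u` in the direction `e` into a function `v` on `[0,1]` with weak
derivative `w = v^{(k)}`. The terms with `ℓ` derivatives in `θ` only contribute a factor
`m ^ (2 ℓ)`, so the orthogonality becomes `(1 + m ^ (2 ℓ)) (⟪v, q⟫ + ⟪w, q^{(k)}⟫) = 0` for all
polynomials `q`. By du Bois-Reymond's lemma, `v` is the `k`-fold primitive of `w` up to a polynomial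
of degree less than `k`; approximating `w` by polynomials in `L²` shows that `v` is approximated by
polynomials in `H^k(0,1)`, and so `v = 0` (`ae_eq_zero_of_orthogonal_polynomials`). Parseval's
identity in the angle then yields `u = 0` (`eq_zero_of_orthogonal_polyTrigTensors`).
-/

/-! ### Cardinal B-splines -/

/-- The truncated power `y₊ⁿ`, with the right-continuous convention `y₊⁰ = 1` for `y ≥ 0`. -/
noncomputable def truncPow (n : ℕ) (y : ℝ) : ℝ := if 0 ≤ y then y ^ n else 0

/-- The cardinal B-spline of degree `n`, with knots `0, 1, …, n + 1`, as a linear combination of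
truncated powers. -/
noncomputable def cardinalBSpline (n : ℕ) (y : ℝ) : ℝ :=
  (∑ r ∈ Finset.range (n + 2), (-1) ^ r * ((n + 1).choose r : ℝ) * truncPow n (y - r)) /
    (n.factorial : ℝ)

theorem truncPow_succ (n : ℕ) (y : ℝ) : truncPow (n + 1) y = y * truncPow n y := by
  unfold truncPow
  split_ifs <;> ring

theorem cardinalBSpline_succ (n : ℕ) (y : ℝ) :
    cardinalBSpline (n + 1) y = y / (n + 1) * cardinalBSpline n y +
      (n + 2 - y) / (n + 1) * cardinalBSpline n (y - 1) := by
  have hA : ∑ r ∈ Finset.range (n + 2), (-1) ^ r * ((n + 1).choose r : ℝ) * truncPow n (y - r) =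
      ∑ r ∈ Finset.range (n + 2),
        (-1) ^ (r + 1) * ((n + 1).choose (r + 1) : ℝ) * truncPow n (y - r - 1) + truncPow n y := by
    have h := Finset.sum_range_succ
      (fun r : ℕ => (-1) ^ r * ((n + 1).choose r : ℝ) * truncPow n (y - r)) (n + 2)
    rw [Finset.sum_range_succ'] at h
    simp only [Nat.choose_succ_self, Nat.cast_zero, mul_zero, zero_mul, add_zero, pow_zero,
      Nat.choose_zero_right, Nat.cast_one, one_mul, sub_zero, Nat.cast_add] at h
    rw [← h]
    simp only [sub_sub]
  have hB : ∑ r ∈ Finset.range (n + 1 + 2),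
        (-1) ^ r * ((n + 1 + 1).choose r : ℝ) * truncPow (n + 1) (y - r) =
      ∑ r ∈ Finset.range (n + 2), (-1) ^ (r + 1) *
        (((n + 1).choose r : ℝ) + ((n + 1).choose (r + 1) : ℝ)) *
          ((y - r - 1) * truncPow n (y - r - 1)) + y * truncPow n y := by
    rw [Finset.sum_range_succ']
    simp only [truncPow_succ, pow_zero, Nat.choose_zero_right, Nat.cast_one, one_mul,
      Nat.cast_zero, sub_zero, Nat.cast_add, Nat.choose_succ_succ (n + 1), sub_sub]
  have hC : ∀ r ∈ Finset.range (n + 2),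
      ((n + 1).choose (r + 1) : ℝ) * (r + 1) = (n + 1).choose r * (n + 1 - r) := by
    intro r hr
    have hr' : r ≤ n + 1 := by simpa [Nat.lt_succ_iff] using hr
    have := Nat.choose_succ_right_eq (n + 1) r
    have h2 : (((n + 1 - r : ℕ)) : ℝ) = n + 1 - r := by push_cast [Nat.cast_sub hr']; ring
    rw [← h2]
    exact_mod_cast this
  unfold cardinalBSpline
  rw [hA, hB, Nat.factorial_succ]
  have hn : (n + 1 : ℝ) ≠ 0 := by positivity
  have hf : (n.factorial : ℝ) ≠ 0 := by positivity
  push_cast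
  field_simp
  have : ∀ r ∈ Finset.range (n + 2), (-1) ^ (r + 1) *
        (((n + 1).choose r : ℝ) + ((n + 1).choose (r + 1) : ℝ)) *
          (y - r - 1) * truncPow n (y - r - 1) =
      y * ((-1) ^ (r + 1) * ((n + 1).choose (r + 1) : ℝ) * truncPow n (y - r - 1)) +
      (n + 2 - y) * ((-1) ^ r * ((n + 1).choose r : ℝ) * truncPow n (y - 1 - r)) := by
    intro r hr
    have h := hC r hr
    have h1 : y - 1 - (r : ℝ) = y - r - 1 := by ring
    rw [h1, pow_succ]
    linear_combination (-1) ^ r * truncPow n (y - r - 1) * h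
  rw [Finset.sum_congr rfl this, Finset.sum_add_distrib, ← Finset.mul_sum, ← Finset.mul_sum]
  ring

theorem cardinalBSpline_zero (y : ℝ) :
    cardinalBSpline 0 y = if 0 ≤ y ∧ y < 1 then 1 else 0 := by
  simp only [cardinalBSpline, truncPow, Finset.sum_range_succ, Finset.sum_range_zero]
  norm_num
  split_ifs <;> first | (norm_num; done) | (exfalso; grind)

/-- On equidistant knots, the Cox–de Boor recursion produces rescaled translates of the cardinal
B-spline. -/
theorem bspline_uniform {τ : ℕ → ℝ} {a h : ℝ} (hh : 0 < h) (hτ : ∀ j, τ j = h * (j + a))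
    (n i : ℕ) (x : ℝ) : bspline τ n i x = cardinalBSpline n (x / h - (i + a)) := by
  induction n generalizing i with
  | zero =>
    simp only [bspline, cardinalBSpline_zero, hτ]
    have h1 : x = h * (x / h) := by field_simp
    have e1 : h * (i + a) ≤ x ↔ 0 ≤ x / h - (i + a) := by
      rw [sub_nonneg, le_div_iff₀ hh, mul_comm]
    have e2 : x < h * ((i + 1 : ℕ) + a) ↔ x / h - (i + a) < 1 := by
      rw [sub_lt_iff_lt_add, div_lt_iff₀ hh]; push_cast
      rw [show (1 + (i + a)) * h = h * (i + 1 + a) by ring]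
    simp only [e1, e2]
  | succ n ih =>
    simp only [bspline, ih, cardinalBSpline_succ, hτ]
    have hn : (n + 1 : ℝ) ≠ 0 := by positivity
    have e : x / h - ((i + 1 : ℕ) + a) = x / h - (i + a) - 1 := by push_cast; ring
    rw [e]
    have d1 : h * ((i + n + 1 : ℕ) + a) - h * (i + a) = h * (n + 1) := by push_cast; ring
    have d2 : h * ((i + n + 2 : ℕ) + a) - h * ((i + 1 : ℕ) + a) = h * (n + 1) := by
      push_cast; ring
    rw [d1, d2]
    congr 2
    · field_simp
    · push_cast
      field_simp
      ring

theorem cardinalBSpline_nonneg_and_support (n : ℕ) (y : ℝ) :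
    0 ≤ cardinalBSpline n y ∧ (cardinalBSpline n y ≠ 0 → 0 ≤ y ∧ y < n + 1) := by
  induction n generalizing y with
  | zero =>
    rw [cardinalBSpline_zero]
    split_ifs with h
    · simpa using h
    · simp
  | succ n ih =>
    obtain ⟨h1, h2⟩ := ih y
    obtain ⟨h3, h4⟩ := ih (y - 1)
    rw [cardinalBSpline_succ]
    have hn : (0 : ℝ) < n + 1 := by positivity
    constructor
    · refine add_nonneg ?_ ?_
      · by_cases h : cardinalBSpline n y = 0
        · simp [h]
        · exact mul_nonneg (div_nonneg (h2 h).1 hn.le) h1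
      · by_cases h : cardinalBSpline n (y - 1) = 0
        · simp [h]
        · exact mul_nonneg (div_nonneg (by linarith [(h4 h).2]) hn.le) h3
    · intro h
      push_cast
      by_contra hy
      apply h
      have e1 : cardinalBSpline n y = 0 := by
        by_contra h'
        exact hy ⟨(h2 h').1, by linarith [(h2 h').2]⟩
      have e2 : cardinalBSpline n (y - 1) = 0 := by
        by_contra h'
        exact hy ⟨by linarith [(h4 h').1], by linarith [(h4 h').2]⟩
      simp [e1, e2]

theorem cardinalBSpline_nonneg (n : ℕ) (y : ℝ) : 0 ≤ cardinalBSpline n y :=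
  (cardinalBSpline_nonneg_and_support n y).1

theorem mem_Ico_of_cardinalBSpline_ne_zero {n : ℕ} {y : ℝ} (h : cardinalBSpline n y ≠ 0) :
    0 ≤ y ∧ y < n + 1 :=
  (cardinalBSpline_nonneg_and_support n y).2 h

theorem continuous_truncPow (n : ℕ) : Continuous (truncPow (n + 1)) := by
  have : truncPow (n + 1) = fun y => (max y 0) ^ (n + 1) := by
    ext y
    unfold truncPow
    split_ifs with h
    · rw [max_eq_left h]
    · rw [max_eq_right (not_le.1 h).le, zero_pow (Nat.succ_ne_zero n)]
  rw [this]
  fun_prop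

theorem measurable_truncPow (n : ℕ) : Measurable (truncPow n) := by
  unfold truncPow
  exact Measurable.ite measurableSet_Ici (by fun_prop) measurable_const

theorem measurable_cardinalBSpline (n : ℕ) : Measurable (cardinalBSpline n) := by
  unfold cardinalBSpline
  have := measurable_truncPow n
  fun_prop

theorem continuous_cardinalBSpline (n : ℕ) : Continuous (cardinalBSpline (n + 1)) := by
  unfold cardinalBSpline
  have := continuous_truncPow n
  fun_prop

theorem hasDerivWithinAt_truncPow (n : ℕ) (y : ℝ) :
    HasDerivWithinAt (truncPow (n + 1)) ((n + 1) * truncPow n y) (Ioi y) y := by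
  unfold truncPow
  rcases le_or_gt 0 y with h | h
  · have h1 : HasDerivWithinAt (fun y : ℝ => y ^ (n + 1)) ((n + 1) * y ^ n) (Ioi y) y := by
      simpa using (hasDerivAt_pow (n + 1) y).hasDerivWithinAt (s := Ioi y)
    rw [if_pos h]
    refine h1.congr (fun z hz => ?_) ?_
    · rw [if_pos (h.trans (le_of_lt hz))]
    · rw [if_pos h]
  · rw [if_neg (not_le.2 h), mul_zero]
    refine ((hasDerivAt_const y (0 : ℝ)).congr_of_eventuallyEq ?_).hasDerivWithinAt
    filter_upwards [Iio_mem_nhds h] with z hz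
    rw [if_neg (not_le.2 hz)]

/-- The derivative of a B-spline is a difference of B-splines of lower degree. The derivative is
taken from the right, which makes the formula valid at the knots too. -/
theorem hasDerivWithinAt_cardinalBSpline (n : ℕ) (y : ℝ) :
    HasDerivWithinAt (cardinalBSpline (n + 1)) (cardinalBSpline n y - cardinalBSpline n (y - 1))
      (Ioi y) y := by
  have hd : HasDerivWithinAt (cardinalBSpline (n + 1))
      ((∑ r ∈ Finset.range (n + 1 + 2), (-1) ^ r * ((n + 1 + 1).choose r : ℝ) *
        ((n + 1) * truncPow n (y - r))) / ((n + 1).factorial : ℝ)) (Ioi y) y := by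
    unfold cardinalBSpline
    refine HasDerivWithinAt.div_const (HasDerivWithinAt.fun_sum fun r _ => ?_) _
    refine HasDerivWithinAt.const_mul _ ?_
    have := (hasDerivWithinAt_truncPow n (y - r)).scomp y
      (((hasDerivAt_id y).sub_const (r : ℝ)).hasDerivWithinAt (s := Ioi y))
      (fun z hz => by simpa using hz)
    simpa [Function.comp_def] using this
  convert hd using 1
  unfold cardinalBSpline
  rw [Nat.factorial_succ, ← sub_div, div_eq_div_iff (by positivity) (by positivity)]
  have h := Finset.sum_range_succ
      (fun r : ℕ => (-1) ^ r * ((n + 1).choose r : ℝ) * truncPow n (y - r)) (n + 2)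
  simp only [Nat.choose_succ_self, Nat.cast_zero, mul_zero, zero_mul, add_zero] at h
  rw [← h, Finset.sum_range_succ', Finset.sum_range_succ' _ (n + 1 + 1)]
  have e : ∀ r : ℕ, y - ((r + 1 : ℕ) : ℝ) = y - 1 - r := fun r => by push_cast; ring
  simp only [Nat.choose_succ_succ (n + 1), e, Nat.choose_zero_right, pow_zero, Nat.cast_zero,
    sub_zero]
  push_cast
  simp only [pow_succ, mul_add, add_mul, Finset.sum_add_distrib, mul_neg, neg_mul, mul_one, one_mul,
    Finset.sum_neg_distrib, Finset.sum_mul, sub_mul]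
  simp only [mul_assoc, mul_comm, mul_left_comm]
  ring

/-! ### Marsden's identity and the splines on `[0,1]` -/

theorem bspline_ne_zero {τ : ℕ → ℝ} (hτ : Monotone τ) {n i : ℕ} {x : ℝ}
    (h : bspline τ n i x ≠ 0) : τ i ≤ x ∧ x < τ (i + n + 1) := by
  induction n generalizing i with
  | zero =>
    by_contra h'
    exact h (if_neg h')
  | succ n ih =>
    rw [bspline] at h
    by_cases h0 : bspline τ n i x = 0
    · have h1 : bspline τ n (i + 1) x ≠ 0 := fun h1 => h (by simp [h0, h1])
      have h2 := ih h1
      exact ⟨(hτ (Nat.le_succ i)).trans h2.1, h2.2.trans_le (hτ (by omega))⟩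
    · have h2 := ih h0
      exact ⟨h2.1, h2.2.trans_le (hτ (by omega))⟩

/-- **Marsden's identity**: on a knot interval which is preceded by at least `n` knots, the
polynomial `x ↦ (y - x)ⁿ` is a combination of the B-splines of degree `n`. -/
theorem marsden_identity {τ : ℕ → ℝ} (hτ : Monotone τ) {p K : ℕ} (hpK : p < K) {x : ℝ}
    (hx : τ p ≤ x) (hx' : x < τ (p + 1)) (y : ℝ) (n : ℕ) (hn : n ≤ p) :
    ∑ i ∈ Finset.range K, (∏ r ∈ Finset.range n, (y - τ (i + r + 1))) * bspline τ n i x =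
      (y - x) ^ n := by
  induction n with
  | zero =>
    rw [Finset.sum_eq_single_of_mem p (Finset.mem_range.2 hpK)]
    · simp [bspline, hx, hx']
    · intro i _ hi
      have : bspline τ 0 i x = 0 := by
        by_contra h
        have h2 := bspline_ne_zero hτ h
        rcases lt_or_gt_of_ne hi with h3 | h3
        · exact absurd (h2.2.trans_le (hτ (show i + 0 + 1 ≤ p by omega))) (not_lt.2 hx)
        · exact absurd ((hτ (show p + 1 ≤ i by omega)).trans h2.1) (not_le.2 hx')
      simp [this]
  | succ n ih =>
    rw [pow_succ, ← ih (by omega), Finset.sum_mul]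
    have h0 : bspline τ n 0 x = 0 := by
      by_contra h
      exact absurd ((bspline_ne_zero hτ h).2.trans_le (hτ (by omega))) (not_lt.2 hx)
    have hK : bspline τ n K x = 0 := by
      by_contra h
      exact absurd ((hτ (show p + 1 ≤ K by omega)).trans (bspline_ne_zero hτ h).1) (not_le.2 hx')
    -- the second terms of the recursion, reindexed by the B-spline of degree `n` they contain
    have hshift : ∑ i ∈ Finset.range K, (∏ r ∈ Finset.range (n + 1), (y - τ (i + r + 1))) *
          ((τ (i + n + 2) - x) / (τ (i + n + 2) - τ (i + 1)) * bspline τ n (i + 1) x) =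
        ∑ i ∈ Finset.range K, (∏ r ∈ Finset.range (n + 1), (y - τ (i + r))) *
          ((τ (i + n + 1) - x) / (τ (i + n + 1) - τ i) * bspline τ n i x) := by
      have h := Finset.sum_range_succ (fun i => (∏ r ∈ Finset.range (n + 1), (y - τ (i + r))) *
          ((τ (i + n + 1) - x) / (τ (i + n + 1) - τ i) * bspline τ n i x)) K
      rw [Finset.sum_range_succ', h0, hK] at h
      simp only [mul_zero, add_zero] at h
      rw [← h]
      refine Finset.sum_congr rfl fun i _ => ?_
      congr 1
      · exact Finset.prod_congr rfl fun r _ => by rw [show i + 1 + r = i + r + 1 by omega]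
      · rw [show i + 1 + n + 1 = i + n + 2 by omega]
    simp only [bspline, mul_add, Finset.sum_add_distrib, hshift]
    rw [← Finset.sum_add_distrib]
    refine Finset.sum_congr rfl fun i _ => ?_
    by_cases hB : bspline τ n i x = 0
    · simp [hB]
    have hlt : τ i < τ (i + n + 1) := (bspline_ne_zero hτ hB).1.trans_lt (bspline_ne_zero hτ hB).2
    have hne : τ (i + n + 1) - τ i ≠ 0 := (sub_pos.2 hlt).ne'
    rw [Finset.prod_range_succ, Finset.prod_range_succ']
    simp only [add_zero, ← add_assoc]
    field_simp
    ring

/-- Truncating the sum in Marsden's identity at a knot yields a truncated power. -/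
theorem marsden_identity_truncated {τ : ℕ → ℝ} (hτ : Monotone τ) {p K : ℕ} (hpK : p < K) {x : ℝ}
    (hx : τ p ≤ x) (hx' : x < τ (p + 1)) (q n : ℕ) (hn : n ≤ p) :
    ∑ i ∈ Finset.range K, (if q ≤ i then ∏ r ∈ Finset.range n, (τ q - τ (i + r + 1)) else 0) *
      bspline τ n i x = if τ q ≤ x then (τ q - x) ^ n else 0 := by
  split_ifs with h
  · rw [← marsden_identity hτ hpK hx hx' (τ q) n hn]
    refine Finset.sum_congr rfl fun i _ => ?_
    split_ifs with hqi
    · rfl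
    · by_cases hB : bspline τ n i x = 0
      · simp [hB]
      have h1 : q < i + n + 1 := by
        by_contra h1
        exact absurd ((hτ (not_lt.1 h1)).trans h) (not_le.2 (bspline_ne_zero hτ hB).2)
      have : ∏ r ∈ Finset.range n, (τ q - τ (i + r + 1)) = 0 := by
        refine Finset.prod_eq_zero (i := q - i - 1) (Finset.mem_range.2 (by omega)) ?_
        rw [show i + (q - i - 1) + 1 = q by omega, sub_self]
      simp [this]
  · refine Finset.sum_eq_zero fun i _ => ?_
    split_ifs with hqi
    · have : bspline τ n i x = 0 := by
        by_contra hB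
        exact h ((hτ hqi).trans (bspline_ne_zero hτ hB).1)
      simp [this]
    · simp

theorem monotone_knotT (n : ℕ) {N : ℕ} (hN : 0 < N) : Monotone (knotT n N) := by
  have hN' : (0 : ℝ) < N := by exact_mod_cast hN
  refine monotone_nat_of_le_succ fun i => ?_
  unfold knotT
  split_ifs with h1 h2 h3 h4 h5 h6
  any_goals omega
  · exact le_rfl
  · have : (n : ℝ) ≤ (i + 1 : ℕ) := by exact_mod_cast (by omega)
    exact div_nonneg (by linarith) hN'.le
  · gcongr; simp
  · rw [div_le_one hN']
    have : (i : ℝ) ≤ (n + N : ℕ) := by exact_mod_cast (by omega)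
    push_cast at this
    linarith
  · exact le_rfl

/-- The functions which agree on `[0,1)` with a combination of the B-splines `B_i`. -/
def splineFunT (n N : ℕ) : Submodule ℝ (ℝ → ℝ) where
  carrier := {F | ∃ s : ℕ → ℝ, ∀ x ∈ Ico (0 : ℝ) 1,
    F x = ∑ i ∈ Finset.range (n + N), s i * splineB n N i x}
  zero_mem' := ⟨0, fun x _ => by simp⟩
  add_mem' := by
    rintro F G ⟨s, hs⟩ ⟨s', hs'⟩
    refine ⟨s + s', fun x hx => ?_⟩
    simp [hs x hx, hs' x hx, add_mul, Finset.sum_add_distrib]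
  smul_mem' := by
    rintro c F ⟨s, hs⟩
    refine ⟨c • s, fun x hx => ?_⟩
    simp [hs x hx, Finset.mul_sum, mul_assoc]

theorem truncPow_mem_splineFunT (n : ℕ) {N : ℕ} (hN : 0 < N) (q : ℤ) :
    (fun x : ℝ => truncPow n (N * x - q)) ∈ splineFunT n N := by
  have hN' : (0 : ℝ) < N := by exact_mod_cast hN
  have hτ := monotone_knotT n hN
  have hp : ∀ x ∈ Ico (0 : ℝ) 1, ∃ p : ℕ, n ≤ p ∧ p < n + N ∧ knotT n N p ≤ x ∧
      x < knotT n N (p + 1) := by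
    intro x hx
    have h0 : 0 ≤ N * x := mul_nonneg hN'.le hx.1
    have h1 := Nat.floor_le h0
    have h2 := Nat.lt_floor_add_one (N * x)
    have h3 : ⌊N * x⌋₊ < N := (Nat.floor_lt h0).2 (by nlinarith [hx.2])
    refine ⟨n + ⌊N * x⌋₊, by omega, by omega, ?_, ?_⟩
    · rw [knotT, if_neg (by omega), if_pos (by omega), div_le_iff₀ hN']
      push_cast
      linarith
    · rw [knotT, if_neg (by omega)]
      split_ifs
      · rw [lt_div_iff₀ hN']
        push_cast
        linarith
      · exact hx.2
  have hval : ∀ x : ℝ, (-N : ℝ) ^ n * ((q : ℝ) / N - x) ^ n = (N * x - q) ^ n := by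
    intro x
    rw [← mul_pow]
    congr 1
    field_simp
    ring
  rcases le_or_gt q 0 with hq | hq
  · refine ⟨fun i => (-N) ^ n * ∏ r ∈ Finset.range n, ((q : ℝ) / N - knotT n N (i + r + 1)),
      fun x hx => ?_⟩
    obtain ⟨p, h1, h2, h3, h4⟩ := hp x hx
    have hq' : (q : ℝ) ≤ 0 := by exact_mod_cast hq
    have := marsden_identity hτ h2 h3 h4 ((q : ℝ) / N) n h1
    simp only [mul_assoc, splineB]
    rw [← Finset.mul_sum, this, hval, truncPow, if_pos]
    nlinarith [hx.1]
  · lift q to ℕ using hq.le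
    by_cases hqN : q < N
    · refine ⟨fun i => (-N) ^ n * if n + q ≤ i then
        ∏ r ∈ Finset.range n, (knotT n N (n + q) - knotT n N (i + r + 1)) else 0, fun x hx => ?_⟩
      obtain ⟨p, h1, h2, h3, h4⟩ := hp x hx
      have := marsden_identity_truncated hτ h2 h3 h4 (n + q) n h1
      simp only [mul_assoc, splineB]
      rw [← Finset.mul_sum, this]
      have hk : knotT n N (n + q) = (q : ℝ) / N := by
        rw [knotT, if_neg (by omega), if_pos (by omega)]
        push_cast
        ring
      have hv := hval x
      rw [hk, truncPow]
      push_cast at hv ⊢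
      have hiff : (q : ℝ) / N ≤ x ↔ 0 ≤ N * x - q := by
        rw [div_le_iff₀ hN', sub_nonneg, mul_comm]
      simp only [hiff]
      split_ifs
      · rw [hv]
      · simp
    · refine ⟨0, fun x hx => ?_⟩
      have h1 : (N : ℝ) ≤ q := by exact_mod_cast not_lt.1 hqN
      have h2 : ¬ 0 ≤ N * x - ((q : ℤ) : ℝ) := by
        push_cast
        nlinarith [hx.2]
      simp only [truncPow, if_neg h2, Pi.zero_apply, zero_mul, Finset.sum_const_zero]

theorem cardinalBSpline_mem_splineFunT (n : ℕ) {N : ℕ} (hN : 0 < N) (j : ℤ) :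
    (fun x : ℝ => cardinalBSpline n (N * x - j)) ∈ splineFunT n N := by
  have h := (splineFunT n N).smul_mem ((n.factorial : ℝ)⁻¹) (Submodule.sum_mem (splineFunT n N)
    (t := Finset.range (n + 2))
    (f := fun r => ((-1) ^ r * ((n + 1).choose r : ℝ)) •
      fun x : ℝ => truncPow n (N * x - ((j + r : ℤ) : ℝ)))
    fun r _ => Submodule.smul_mem _ _ (truncPow_mem_splineFunT n hN (j + r)))
  convert h using 1
  ext x
  simp only [cardinalBSpline, Pi.smul_apply, Finset.sum_apply, smul_eq_mul, div_eq_inv_mul]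
  congr 1
  refine Finset.sum_congr rfl fun r _ => ?_
  push_cast
  rw [sub_sub]

/-! ### Quasi-interpolants on a uniform grid -/

/-- The spline `∑ⱼ f(h j) B(x / h - j)` of degree `n` on the grid `h ℤ` with coefficients sampled
from `f`, where `B` is the cardinal B-spline. -/
noncomputable def quasiInterp (n : ℕ) (h : ℝ) (f : ℝ → ℝ) (x : ℝ) : ℝ :=
  ∑ᶠ j : ℤ, f (h * j) * cardinalBSpline n (x / h - j)

theorem mem_Icc_of_cardinalBSpline_ne_zero {n : ℕ} {y : ℝ} {M : ℕ} (hM : |y| + (n + 1) ≤ M)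
    {j : ℤ} (hj : cardinalBSpline n (y - j) ≠ 0) : j ∈ Finset.Icc (-M : ℤ) M := by
  obtain ⟨h1, h2⟩ := mem_Ico_of_cardinalBSpline_ne_zero hj
  have h3 := abs_le.1 (le_refl |y|)
  have hn : (0 : ℝ) ≤ n := Nat.cast_nonneg n
  rw [Finset.mem_Icc]
  constructor
  · have : (-M : ℝ) ≤ j := by linarith [h3.1]
    exact_mod_cast this
  · have : (j : ℝ) ≤ M := by linarith [h3.2]
    exact_mod_cast this

theorem finsum_mul_cardinalBSpline_eq_sum (a : ℤ → ℝ) {n : ℕ} {y : ℝ} {M : ℕ}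
    (hM : |y| + (n + 1) ≤ M) :
    ∑ᶠ j : ℤ, a j * cardinalBSpline n (y - j) =
      ∑ j ∈ Finset.Icc (-M : ℤ) M, a j * cardinalBSpline n (y - j) := by
  refine finsum_eq_sum_of_support_subset _ fun j hj => ?_
  exact mem_Icc_of_cardinalBSpline_ne_zero hM (right_ne_zero_of_mul hj)

theorem hasFiniteSupport_mul_cardinalBSpline (a : ℤ → ℝ) (n : ℕ) (y : ℝ) :
    (Function.support fun j : ℤ => a j * cardinalBSpline n (y - j)).Finite := by
  obtain ⟨M, hM⟩ := exists_nat_ge (|y| + (n + 1))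
  exact (Finset.finite_toSet (Finset.Icc (-M : ℤ) M)).subset fun j hj =>
    mem_Icc_of_cardinalBSpline_ne_zero hM (right_ne_zero_of_mul hj)

theorem finsum_shift (a : ℤ → ℝ) (b : ℤ → ℝ) (n : ℕ) (y : ℝ) (N : ℤ)
    (hab : ∀ j, b (j + N) = a j) :
    ∑ᶠ j : ℤ, b j * cardinalBSpline n (y - j) =
      ∑ᶠ j : ℤ, a j * cardinalBSpline n (y - N - j) := by
  rw [← finsum_comp_equiv (Equiv.addRight N)]
  refine finsum_congr fun j => ?_
  rw [Equiv.coe_addRight, hab]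
  push_cast
  rw [sub_sub, add_comm (N : ℝ)]

/-- The cardinal B-splines form a partition of unity. -/
theorem finsum_cardinalBSpline (n : ℕ) (y : ℝ) :
    ∑ᶠ j : ℤ, (1 : ℝ) * cardinalBSpline n (y - j) = 1 := by
  induction n with
  | zero =>
    rw [finsum_eq_single _ ⌊y⌋]
    · rw [cardinalBSpline_zero, if_pos, mul_one]
      exact ⟨sub_nonneg.2 (Int.floor_le y), by linarith [Int.lt_floor_add_one y]⟩
    · intro j hj
      by_contra h
      obtain ⟨h1, h2⟩ := mem_Ico_of_cardinalBSpline_ne_zero (right_ne_zero_of_mul h)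
      refine hj (Int.floor_eq_iff.2 ⟨by linarith, ?_⟩).symm
      push_cast at h2
      linarith
  | succ n ih =>
    have hn : (n + 1 : ℝ) ≠ 0 := by positivity
    have e : ∀ j : ℤ, (1 : ℝ) * cardinalBSpline (n + 1) (y - j) =
        (y - j) / (n + 1) * cardinalBSpline n (y - j) +
          (n + 2 - (y - j)) / (n + 1) * cardinalBSpline n (y - 1 - j) := fun j => by
      rw [one_mul, cardinalBSpline_succ, sub_right_comm]
    simp only [e]
    have hs := finsum_shift (fun j : ℤ => (n + 2 - (y - j)) / (n + 1))
      (fun j : ℤ => (n + 1 - (y - j)) / (n + 1)) n y 1 (fun j => by push_cast; ring)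
    rw [Int.cast_one] at hs
    rw [finsum_add_distrib (hasFiniteSupport_mul_cardinalBSpline _ n y)
      (hasFiniteSupport_mul_cardinalBSpline _ n (y - 1)), ← hs,
      ← finsum_add_distrib (hasFiniteSupport_mul_cardinalBSpline _ n y)
        (hasFiniteSupport_mul_cardinalBSpline _ n y)]
    refine Eq.trans (finsum_congr fun j => ?_) ih
    field_simp
    ring

theorem quasiInterp_eq_sum {n : ℕ} {h : ℝ} (f : ℝ → ℝ) {x : ℝ} {M : ℕ}
    (hM : |x / h| + (n + 1) ≤ M) :
    quasiInterp n h f x =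
      ∑ j ∈ Finset.Icc (-M : ℤ) M, f (h * j) * cardinalBSpline n (x / h - j) :=
  finsum_mul_cardinalBSpline_eq_sum (fun j => f (h * j)) hM

/-- A quasi-interpolant is locally a convex combination of the sampled values. -/
theorem abs_quasiInterp_sub_le {n : ℕ} {h : ℝ} (hh : 0 < h) {f : ℝ → ℝ} {x c ε : ℝ}
    (hf : ∀ y, x - (n + 1) * h ≤ y → y ≤ x → |f y - c| ≤ ε) :
    |quasiInterp n h f x - c| ≤ ε := by
  obtain ⟨M, hM⟩ := exists_nat_ge (|x / h| + (n + 1))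
  have h1 := finsum_cardinalBSpline n (x / h)
  rw [finsum_mul_cardinalBSpline_eq_sum (fun _ => 1) hM] at h1
  have h2 : quasiInterp n h f x - c =
      ∑ j ∈ Finset.Icc (-M : ℤ) M, (f (h * j) - c) * cardinalBSpline n (x / h - j) := by
    simp only [sub_mul, Finset.sum_sub_distrib, ← quasiInterp_eq_sum f hM]
    simp only [one_mul] at h1
    rw [← Finset.mul_sum, h1, mul_one]
  rw [h2]
  calc _ ≤ ∑ j ∈ Finset.Icc (-M : ℤ) M, |(f (h * j) - c) * cardinalBSpline n (x / h - j)| :=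
        Finset.abs_sum_le_sum_abs _ _
    _ ≤ ∑ j ∈ Finset.Icc (-M : ℤ) M, ε * (1 * cardinalBSpline n (x / h - j)) := by
        refine Finset.sum_le_sum fun j _ => ?_
        rw [abs_mul, abs_of_nonneg (cardinalBSpline_nonneg _ _), one_mul]
        by_cases hB : cardinalBSpline n (x / h - j) = 0
        · simp [hB]
        obtain ⟨h3, h4⟩ := mem_Ico_of_cardinalBSpline_ne_zero hB
        have hx : x = h * (x / h) := by field_simp
        refine mul_le_mul_of_nonneg_right (hf _ ?_ ?_) (cardinalBSpline_nonneg _ _)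
        · nlinarith
        · nlinarith
    _ = ε := by rw [← Finset.mul_sum, h1, mul_one]

theorem measurable_quasiInterp (n : ℕ) (h : ℝ) (f : ℝ → ℝ) : Measurable (quasiInterp n h f) := by
  refine measurable_of_tendsto_metrizable (f := fun (M : ℕ) x =>
    ∑ j ∈ Finset.Icc (-M : ℤ) M, f (h * j) * cardinalBSpline n (x / h - j)) (fun M => ?_) ?_
  · have := measurable_cardinalBSpline n
    fun_prop
  · rw [tendsto_pi_nhds]
    intro x
    obtain ⟨M, hM⟩ := exists_nat_ge (|x / h| + (n + 1))
    refine tendsto_const_nhds.congr' ?_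
    filter_upwards [eventually_ge_atTop M] with K hK
    exact quasiInterp_eq_sum f (hM.trans (by exact_mod_cast hK))

theorem quasiInterp_eventuallyEq (n : ℕ) (h : ℝ) (f : ℝ → ℝ) (x : ℝ) :
    ∃ M : ℕ, quasiInterp n h f =ᶠ[𝓝 x] fun x =>
      ∑ j ∈ Finset.Icc (-M : ℤ) M, f (h * j) * cardinalBSpline n (x / h - j) := by
  obtain ⟨M, hM⟩ := exists_nat_ge (|x / h| + 1 + (n + 1))
  refine ⟨M, ?_⟩
  have hc : ContinuousAt (fun y : ℝ => |y / h|) x := by fun_prop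
  filter_upwards [hc.eventually_lt_const (lt_add_one (|x / h|))] with y hy
  exact quasiInterp_eq_sum f (by linarith)

theorem continuous_quasiInterp (n : ℕ) (h : ℝ) (f : ℝ → ℝ) :
    Continuous (quasiInterp (n + 1) h f) := by
  rw [continuous_iff_continuousAt]
  intro x
  obtain ⟨M, hM⟩ := quasiInterp_eventuallyEq (n + 1) h f x
  refine ContinuousAt.congr (Continuous.continuousAt ?_) hM.symm
  have := continuous_cardinalBSpline n
  fun_prop

/-- The backward difference quotient with step `h`. -/
noncomputable def backwardDiff (h : ℝ) (f : ℝ → ℝ) (x : ℝ) : ℝ := (f x - f (x - h)) / h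

theorem hasDerivWithinAt_quasiInterp (n : ℕ) {h : ℝ} (hh : 0 < h) (f : ℝ → ℝ) (x : ℝ) :
    HasDerivWithinAt (quasiInterp (n + 1) h f) (quasiInterp n h (backwardDiff h f) x)
      (Ioi x) x := by
  obtain ⟨M, hM⟩ := exists_nat_ge (|x / h| + 1 + (n + 1 + 1))
  have hloc : quasiInterp (n + 1) h f =ᶠ[𝓝 x] fun x =>
      ∑ j ∈ Finset.Icc (-M : ℤ) M, f (h * j) * cardinalBSpline (n + 1) (x / h - j) := by
    have hc : ContinuousAt (fun y : ℝ => |y / h|) x := by fun_prop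
    filter_upwards [hc.eventually_lt_const (lt_add_one (|x / h|))] with y hy
    exact quasiInterp_eq_sum f (by push_cast; linarith)
  have hd : HasDerivWithinAt (fun x =>
      ∑ j ∈ Finset.Icc (-M : ℤ) M, f (h * j) * cardinalBSpline (n + 1) (x / h - j))
      (∑ j ∈ Finset.Icc (-M : ℤ) M, f (h * j) * (h⁻¹ *
        (cardinalBSpline n (x / h - j) - cardinalBSpline n (x / h - j - 1)))) (Ioi x) x := by
    refine HasDerivWithinAt.fun_sum fun j _ => HasDerivWithinAt.const_mul _ ?_
    have := (hasDerivWithinAt_cardinalBSpline n (x / h - j)).scomp x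
      ((((hasDerivAt_id x).div_const h).sub_const (j : ℝ)).hasDerivWithinAt (s := Ioi x))
      (fun z hz => by simpa using (div_lt_div_iff_of_pos_right hh).2 hz)
    simpa [Function.comp_def] using this
  refine (hd.congr_of_eventuallyEq (hloc.filter_mono nhdsWithin_le_nhds)
    hloc.eq_of_nhds).congr_deriv ?_
  have h1 := finsum_mul_cardinalBSpline_eq_sum (fun j => f (h * j)) (n := n) (y := x / h)
    (M := M) (by linarith)
  have habs : |x / h - 1| ≤ |x / h| + 1 := by simpa using abs_sub (x / h) 1
  have h2 := finsum_mul_cardinalBSpline_eq_sum (fun j => f (h * j)) (n := n) (y := x / h - 1)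
    (M := M) (by linarith)
  -- summation by parts
  have h3 := finsum_shift (fun j => f (h * j)) (fun j => f (h * j - h)) n (x / h) 1
    (fun j => by push_cast; congr 1; ring)
  rw [Int.cast_one, h2] at h3
  have h4 := finsum_mul_cardinalBSpline_eq_sum (fun j => f (h * j - h)) (n := n) (y := x / h)
    (M := M) (by linarith)
  rw [h4] at h3
  rw [quasiInterp_eq_sum (backwardDiff h f) (M := M) (by linarith)]
  have h5 : ∑ j ∈ Finset.Icc (-M : ℤ) M, f (h * j) * (h⁻¹ *
        (cardinalBSpline n (x / h - j) - cardinalBSpline n (x / h - j - 1))) =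
      h⁻¹ * (∑ j ∈ Finset.Icc (-M : ℤ) M, f (h * j) * cardinalBSpline n (x / h - j) -
        ∑ j ∈ Finset.Icc (-M : ℤ) M, f (h * j) * cardinalBSpline n (x / h - 1 - j)) := by
    rw [← Finset.sum_sub_distrib, Finset.mul_sum]
    refine Finset.sum_congr rfl fun j _ => ?_
    rw [sub_right_comm (x / h) 1]
    ring
  rw [h5, ← h3, ← Finset.sum_sub_distrib, Finset.mul_sum]
  refine Finset.sum_congr rfl fun j _ => ?_
  unfold backwardDiff
  ring

theorem quasiInterp_add_period (n : ℕ) {h : ℝ} (hh : 0 < h) {f : ℝ → ℝ} {T : ℝ} {N : ℕ}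
    (hT : T = h * N) (hf : ∀ x, f (x + T) = f x) (x : ℝ) :
    quasiInterp n h f (x + T) = quasiInterp n h f x := by
  unfold quasiInterp
  have := finsum_shift (fun j => f (h * j)) (fun j => f (h * j)) n ((x + T) / h) N
    (fun j => by
      rw [← hf (h * j), hT]
      push_cast
      rw [mul_add])
  rw [this]
  refine finsum_congr fun j => ?_
  congr 3
  rw [hT]
  push_cast
  field_simp
  ring

/-! ### Derivatives of quasi-interpolants and their convergence -/

/-- `F 0, F 1, F 2, …` are the successive derivatives of `F 0`. -/
def DerivChain (F : ℕ → ℝ → ℝ) : Prop := ∀ i x, HasDerivAt (F i) (F (i + 1) x) x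

/-- `S 0, …, S k` are successive right derivatives, all but the last one being continuous. Such
functions are also successive weak derivatives; the last one may have jumps. -/
structure RightDerivChain (k : ℕ) (S : ℕ → ℝ → ℝ) : Prop where
  cont : ∀ i < k, Continuous (S i)
  deriv : ∀ i < k, ∀ x, HasDerivWithinAt (S i) (S (i + 1) x) (Ioi x) x
  meas : ∀ i, Measurable (S i)
  bdd : ∀ i R, ∃ C, ∀ x, |x| ≤ R → |S i x| ≤ C

theorem DerivChain.continuous {F : ℕ → ℝ → ℝ} (hF : DerivChain F) (i : ℕ) : Continuous (F i) :=
  continuous_iff_continuousAt.2 fun x => (hF i x).continuousAt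

theorem exists_bound_of_continuous {f : ℝ → ℝ} (hf : Continuous f) (R : ℝ) :
    ∃ C, ∀ x, |x| ≤ R → |f x| ≤ C := by
  obtain ⟨C, hC⟩ := (isCompact_Icc (a := -R) (b := R)).exists_bound_of_continuousOn
    hf.continuousOn
  exact ⟨C, fun x hx => hC x (abs_le.1 hx)⟩

theorem DerivChain.rightDerivChain {F : ℕ → ℝ → ℝ} (hF : DerivChain F) (k : ℕ) :
    RightDerivChain k F where
  cont i _ := hF.continuous i
  deriv i _ x := (hF i x).hasDerivWithinAt
  meas i := (hF.continuous i).measurable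
  bdd i R := exists_bound_of_continuous (hF.continuous i) R

theorem DerivChain.backwardDiff {F : ℕ → ℝ → ℝ} (hF : DerivChain F) (h : ℝ) :
    DerivChain fun i => backwardDiff h (F i) := by
  intro i x
  have h1 := (hF i (x - h)).comp x ((hasDerivAt_id x).sub_const h)
  have h2 := ((hF i x).sub h1).div_const h
  rw [mul_one] at h2
  exact h2

/-- An iterated difference quotient is a value of the derivative at a nearby point. -/
theorem DerivChain.exists_iterate_backwardDiff_eq {F : ℕ → ℝ → ℝ} (hF : DerivChain F) {h : ℝ}
    (hh : 0 < h) (r : ℕ) (x : ℝ) :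
    ∃ ξ, x - r * h ≤ ξ ∧ ξ ≤ x ∧ (_root_.backwardDiff h)^[r] (F 0) x = F r ξ := by
  induction r generalizing F with
  | zero => exact ⟨x, by simp, le_rfl, rfl⟩
  | succ r ih =>
    obtain ⟨ξ, h1, h2, h3⟩ := ih (hF.backwardDiff h)
    obtain ⟨η, h4, h5⟩ := exists_hasDerivAt_eq_slope (F r) (F (r + 1)) (sub_lt_self ξ hh)
      (hF.continuous r).continuousOn (fun y _ => hF r y)
    refine ⟨η, ?_, by linarith [h4.2], ?_⟩
    · push_cast
      linarith [h4.1]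
    · rw [Function.iterate_succ_apply, h3, h5, _root_.backwardDiff, sub_sub_cancel]

theorem continuous_iterate_backwardDiff {f : ℝ → ℝ} (hf : Continuous f) (h : ℝ) (r : ℕ) :
    Continuous ((backwardDiff h)^[r] f) := by
  induction r with
  | zero => exact hf
  | succ r ih =>
    rw [Function.iterate_succ_apply']
    unfold backwardDiff at ih ⊢
    fun_prop

/-- The spline `quasiInterp n h (F 0)` and its successive derivatives. -/
noncomputable def splineChain (n : ℕ) (h : ℝ) (F : ℕ → ℝ → ℝ) (i : ℕ) : ℝ → ℝ :=
  quasiInterp (n - i) h ((backwardDiff h)^[i] (F 0))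

theorem rightDerivChain_splineChain {k n : ℕ} (hk : k ≤ n) {h : ℝ} (hh : 0 < h)
    {F : ℕ → ℝ → ℝ} (hF : DerivChain F) : RightDerivChain k (splineChain n h F) where
  cont i hi := by
    unfold splineChain
    rw [show n - i = n - (i + 1) + 1 by omega]
    exact continuous_quasiInterp _ _ _
  deriv i hi x := by
    unfold splineChain
    rw [show n - i = n - (i + 1) + 1 by omega, Function.iterate_succ_apply']
    exact hasDerivWithinAt_quasiInterp _ hh _ _
  meas i := measurable_quasiInterp _ _ _
  bdd i R := by
    obtain ⟨C, hC⟩ := exists_bound_of_continuous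
      (continuous_iterate_backwardDiff (hF.continuous 0) h i) (R + ((n - i : ℕ) + 1) * h)
    refine ⟨C, fun x hx => ?_⟩
    have := abs_quasiInterp_sub_le (n := n - i) (x := x) (c := 0) (ε := C) hh
      (f := (backwardDiff h)^[i] (F 0)) (fun y hy hy' => ?_)
    · simpa [splineChain] using this
    · rw [sub_zero]
      refine hC y (abs_le.2 ⟨?_, ?_⟩)
      · linarith [(abs_le.1 hx).1]
      · have : 0 ≤ ((n - i : ℕ) + 1) * h := by positivity
        linarith [(abs_le.1 hx).2]

theorem splineChain_add_period (n : ℕ) {h : ℝ} (hh : 0 < h) {F : ℕ → ℝ → ℝ} {T : ℝ} {N : ℕ}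
    (hT : T = h * N) (hF : ∀ x, F 0 (x + T) = F 0 x) (i : ℕ) (x : ℝ) :
    splineChain n h F i (x + T) = splineChain n h F i x := by
  refine quasiInterp_add_period _ hh hT ?_ x
  induction i with
  | zero => exact hF
  | succ i ih =>
    intro x
    rw [Function.iterate_succ_apply', backwardDiff, backwardDiff, ih x, ← ih (x - h),
      sub_add_eq_add_sub]

/-- The derivatives of the quasi-interpolants converge uniformly on bounded sets to the derivatives
of the sampled function as the step of the grid tends to `0`. -/
theorem DerivChain.tendsto_splineChain {F : ℕ → ℝ → ℝ} (hF : DerivChain F) (n i : ℕ) (R : ℝ)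
    {ε : ℝ} (hε : 0 < ε) :
    ∃ δ > 0, ∀ h, 0 < h → h < δ → ∀ x, |x| ≤ R → |splineChain n h F i x - F i x| ≤ ε := by
  have huc := (isCompact_Icc (a := -(R + 1)) (b := R + 1)).uniformContinuousOn_of_continuous
    (hF.continuous i).continuousOn
  rw [Metric.uniformContinuousOn_iff] at huc
  obtain ⟨δ, hδ, H⟩ := huc ε hε
  set A : ℝ := (n - i : ℕ) + 1 + i with hA
  have hA0 : 0 < A := by positivity
  refine ⟨min δ 1 / A, by positivity, fun h hh hhδ x hx => ?_⟩
  rw [lt_div_iff₀ hA0, lt_min_iff] at hhδ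
  refine abs_quasiInterp_sub_le hh fun y hy hy' => ?_
  obtain ⟨ξ, h1, h2, h3⟩ := hF.exists_iterate_backwardDiff_eq hh i y
  have h4 : x - h * A ≤ ξ := by rw [hA]; linarith
  have hx' := abs_le.1 hx
  rw [h3, ← Real.dist_eq]
  refine (H ξ ⟨by linarith, by linarith⟩ x ⟨by linarith, by linarith⟩ ?_).le
  rw [Real.dist_eq, abs_lt]
  constructor <;> linarith

theorem exists_quasiInterp_eq_splineB (n : ℕ) {N : ℕ} (hN : 0 < N) (f : ℝ → ℝ) :
    ∃ s : Fin (n + N) → ℝ, ∀ x ∈ Ico (0 : ℝ) 1,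
      quasiInterp n (1 / N) f x = ∑ i, s i * splineB n N i x := by
  have hN' : (0 : ℝ) < N := by exact_mod_cast hN
  obtain ⟨s, hs⟩ := Submodule.sum_mem (splineFunT n N)
    (t := Finset.Icc (-((N + n + 1 : ℕ) : ℤ)) (N + n + 1 : ℕ))
    (f := fun j : ℤ => f (1 / N * j) • fun x : ℝ => cardinalBSpline n (N * x - j))
    fun j _ => Submodule.smul_mem _ _ (cardinalBSpline_mem_splineFunT n hN j)
  refine ⟨fun i => s i, fun x hx => ?_⟩
  have e : x / (1 / (N : ℝ)) = N * x := by field_simp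
  rw [Fin.sum_univ_eq_sum_range (fun i => s i * splineB n N i x), ← hs x hx,
    quasiInterp_eq_sum f (M := N + n + 1)]
  · rw [e, Finset.sum_apply]
    rfl
  · rw [e, abs_of_nonneg (mul_nonneg hN'.le hx.1)]
    push_cast
    nlinarith [hx.2]

theorem quasiInterp_eq_splineC (n : ℕ) {N : ℕ} (hN : 0 < N) {f : ℝ → ℝ}
    (hf : ∀ x, f (x + 2 * Real.pi) = f x) (x : ℝ) :
    quasiInterp n (2 * Real.pi / N) f x =
      ∑ j : Fin N, f (2 * Real.pi / N * ((j : ℕ) - n)) * splineC n N j x := by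
  have hN' : (0 : ℝ) < N := by exact_mod_cast hN
  have : NeZero N := ⟨hN.ne'⟩
  set h : ℝ := 2 * Real.pi / N with hh
  have hh0 : 0 < h := by positivity
  have hp : ∀ (m : ℤ) (x : ℝ), f (x - h * N * m) = f x := by
    intro m x
    have h1 : Function.Periodic f (2 * Real.pi) := hf
    have h2 := h1.sub_int_mul_eq m (x := x)
    rwa [show (m : ℝ) * (2 * Real.pi) = h * N * m by rw [hh]; field_simp] at h2
  -- the integers are enumerated as `j - n - N m` with `0 ≤ j < N`
  let e : Fin N × ℤ ≃ ℤ :=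
    (((Equiv.prodComm _ _).trans ((Equiv.neg ℤ).prodCongr (Equiv.refl (Fin N)))).trans
      (Int.divModEquiv N).symm).trans (Equiv.subRight (n : ℤ))
  have he : ∀ p : Fin N × ℤ, ((e p : ℤ) : ℝ) = (p.1 : ℕ) - n - N * p.2 := by
    intro p
    simp [e, Int.divModEquiv]
    ring
  have hfin : (Function.support fun p : Fin N × ℤ =>
      f (h * (e p : ℤ)) * cardinalBSpline n (x / h - (e p : ℤ))).Finite :=
    (hasFiniteSupport_mul_cardinalBSpline (fun j => f (h * j)) n (x / h)).preimage
      e.injective.injOn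
  unfold quasiInterp
  rw [← finsum_comp_equiv e, finsum_curry _ hfin, finsum_eq_sum_of_fintype]
  refine Finset.sum_congr rfl fun j _ => ?_
  unfold splineC
  have hC : ∀ m : ℤ, bspline (knotTheta n N) n j (x + 2 * Real.pi * m) =
      cardinalBSpline n (x / h - (e (j, m) : ℤ)) := by
    intro m
    rw [bspline_uniform (a := -n) hh0 (fun i => by rw [knotTheta, hh]; ring), he]
    congr 1
    rw [hh]
    field_simp
    ring
  simp only [hC]
  have hF : ∀ m : ℤ, f (h * (e (j, m) : ℤ)) = f (h * ((j : ℕ) - n)) := by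
    intro m
    rw [he, ← hp m (h * ((j : ℕ) - n))]
    congr 1
    ring
  simp only [hF]
  rw [mul_finsum]

/-! ### Weak derivatives of tensor products -/

theorem hasDerivAt_partialT {φ : ℝ × ℝ → ℝ} (h : ContDiff ℝ ∞ φ) (t θ : ℝ) :
    HasDerivAt (fun t => φ (t, θ)) (partialT φ (t, θ)) t :=
  ((h.differentiable (by simp)).differentiableAt.hasFDerivAt).comp_hasDerivAt t
    ((hasDerivAt_id t).prodMk (hasDerivAt_const t θ))

theorem hasDerivAt_partialTheta {φ : ℝ × ℝ → ℝ} (h : ContDiff ℝ ∞ φ) (t θ : ℝ) :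
    HasDerivAt (fun θ => φ (t, θ)) (partialTheta φ (t, θ)) θ :=
  ((h.differentiable (by simp)).differentiableAt.hasFDerivAt).comp_hasDerivAt θ
    ((hasDerivAt_const θ t).prodMk (hasDerivAt_id θ))

theorem IsTestFunction.partialT {φ : ℝ × ℝ → ℝ} (h : IsTestFunction φ) :
    IsTestFunction (partialT φ) where
  smooth := contDiff_partialT h.smooth
  periodic t θ := by
    have h1 := hasDerivAt_partialT h.smooth t (θ + 2 * Real.pi)
    simp only [h.periodic] at h1
    exact h1.unique (hasDerivAt_partialT h.smooth t θ)
  compactSupport := by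
    obtain ⟨ε, hε, H⟩ := h.compactSupport
    refine ⟨ε, hε, fun t θ hne => ?_⟩
    by_contra hcon
    refine hne ((hasDerivAt_partialT h.smooth t θ).unique
      ((hasDerivAt_const t (0 : ℝ)).congr_of_eventuallyEq ?_))
    rw [not_and_or, not_le, not_le] at hcon
    rcases hcon with hcon | hcon
    · filter_upwards [Iio_mem_nhds hcon] with s hs
      by_contra h0
      exact absurd (H s θ h0).1 (not_le.2 hs)
    · filter_upwards [Ioi_mem_nhds hcon] with s hs
      by_contra h0
      exact absurd (H s θ h0).2 (not_le.2 hs)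

theorem IsTestFunction.partialTheta {φ : ℝ × ℝ → ℝ} (h : IsTestFunction φ) :
    IsTestFunction (partialTheta φ) where
  smooth := contDiff_partialTheta h.smooth
  periodic t θ := by
    have h1 := (hasDerivAt_partialTheta h.smooth t (θ + 2 * Real.pi)).comp_add_const θ (2 * Real.pi)
    simp only [h.periodic] at h1
    exact h1.unique (hasDerivAt_partialTheta h.smooth t θ)
  compactSupport := by
    obtain ⟨ε, hε, H⟩ := h.compactSupport
    refine ⟨ε, hε, fun t θ hne => ?_⟩
    by_contra hcon
    refine hne ((hasDerivAt_partialTheta h.smooth t θ).unique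
      ((hasDerivAt_const θ (0 : ℝ)).congr_of_eventuallyEq ?_))
    refine Eventually.of_forall fun s => ?_
    by_contra h0
    exact hcon (H t s h0)

theorem integrableOn_of_measurable_of_bound {f : ℝ → ℝ} (hf : Measurable f) {a b C : ℝ}
    (hC : ∀ x ∈ Icc a b, |f x| ≤ C) : IntegrableOn f (Icc a b) :=
  Measure.integrableOn_of_bounded (M := C) (by simp) hf.aestronglyMeasurable
    ((ae_restrict_iff' measurableSet_Icc).2 (ae_of_all _ hC))

/-- Integration by parts against a function which is only differentiable from the right. -/
theorem integral_deriv_mul_eq_neg {u u' S S' : ℝ → ℝ} {a b : ℝ} (hab : a ≤ b)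
    (hu : ∀ x, HasDerivAt u (u' x) x) (hu' : Continuous u') (hS : Continuous S)
    (hS' : ∀ x, HasDerivWithinAt S (S' x) (Ioi x) x) (hint : IntegrableOn S' (Icc a b))
    (hbd : u b * S b = u a * S a) :
    ∫ x in Icc a b, u' x * S x = -∫ x in Icc a b, u x * S' x := by
  have huc : Continuous u := continuous_iff_continuousAt.2 fun x => (hu x).continuousAt
  have h := intervalIntegral.integral_mul_deriv_eq_deriv_mul_of_hasDeriv_right (a := a) (b := b)
    huc.continuousOn hS.continuousOn (fun x _ => (hu x).hasDerivWithinAt) (fun x _ => hS' x)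
    (hu'.intervalIntegrable _ _)
    ((intervalIntegrable_iff_integrableOn_Icc_of_le hab).2 hint)
  rw [hbd, sub_self, zero_sub, intervalIntegral.integral_of_le hab,
    intervalIntegral.integral_of_le hab] at h
  rw [integral_Icc_eq_integral_Ioc, integral_Icc_eq_integral_Ioc, h, neg_neg]

theorem ae_cylMeasure_mem : ∀ᵐ p ∂cylMeasure, p ∈ Icc (0 : ℝ) 1 ×ˢ Ioc (0 : ℝ) (2 * Real.pi) := by
  unfold cylMeasure
  rw [Measure.prod_restrict]
  exact ae_restrict_mem (measurableSet_Icc.prod measurableSet_Ioc)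

theorem abs_le_of_mem_cyl {p : ℝ × ℝ} (hp : p ∈ Icc (0 : ℝ) 1 ×ˢ Ioc (0 : ℝ) (2 * Real.pi)) :
    |p.1| ≤ 2 * Real.pi ∧ |p.2| ≤ 2 * Real.pi := by
  obtain ⟨⟨h1, h2⟩, h3, h4⟩ := hp
  have := Real.pi_gt_three
  exact ⟨abs_le.2 ⟨by linarith, by linarith⟩, abs_le.2 ⟨by linarith, h4⟩⟩

theorem ae_bound_tensor {f g : ℝ → ℝ} (hfb : ∀ R, ∃ C, ∀ x, |x| ≤ R → |f x| ≤ C)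
    (hgb : ∀ R, ∃ C, ∀ x, |x| ≤ R → |g x| ≤ C) :
    ∃ C, ∀ᵐ p ∂cylMeasure, ‖f p.1 * g p.2‖ ≤ C := by
  obtain ⟨C, hC⟩ := hfb (2 * Real.pi)
  obtain ⟨D, hD⟩ := hgb (2 * Real.pi)
  refine ⟨C * D, ?_⟩
  filter_upwards [ae_cylMeasure_mem] with p hp
  have h := abs_le_of_mem_cyl hp
  have h1 := hC _ h.1
  rw [norm_mul]
  exact mul_le_mul h1 (hD _ h.2) (norm_nonneg _) ((abs_nonneg _).trans h1)

theorem aestronglyMeasurable_tensor {f g : ℝ → ℝ} (hf : Measurable f) (hg : Measurable g) :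
    AEStronglyMeasurable (fun p : ℝ × ℝ => f p.1 * g p.2) cylMeasure :=
  ((hf.comp measurable_fst).mul (hg.comp measurable_snd)).aestronglyMeasurable

theorem integrable_mul_tensor {φ : ℝ × ℝ → ℝ} (hφ : Continuous φ) {f g : ℝ → ℝ}
    (hf : Measurable f) (hg : Measurable g) (hfb : ∀ R, ∃ C, ∀ x, |x| ≤ R → |f x| ≤ C)
    (hgb : ∀ R, ∃ C, ∀ x, |x| ≤ R → |g x| ≤ C) :
    Integrable (fun p => φ p * (f p.1 * g p.2)) cylMeasure := by
  obtain ⟨C, hC⟩ := ae_bound_tensor hfb hgb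
  exact ((memLp_cyl_of_continuous hφ).integrable one_le_two).mul_bdd
    (aestronglyMeasurable_tensor hf hg) hC

theorem integral_partialT {k : ℕ} {S : ℕ → ℝ → ℝ} (hS : RightDerivChain k S) {g : ℝ → ℝ}
    (hg : Measurable g) (hgb : ∀ R, ∃ C, ∀ x, |x| ≤ R → |g x| ≤ C) {φ : ℝ × ℝ → ℝ}
    (hφ : IsTestFunction φ) {i : ℕ} (hi : i < k) :
    ∫ p, partialT φ p * (S i p.1 * g p.2) ∂cylMeasure =
      -∫ p, φ p * (S (i + 1) p.1 * g p.2) ∂cylMeasure := by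
  have h1 := integrable_mul_tensor hφ.partialT.smooth.continuous (hS.meas i) hg (hS.bdd i) hgb
  have h2 := integrable_mul_tensor hφ.smooth.continuous (hS.meas (i + 1)) hg (hS.bdd (i + 1)) hgb
  unfold cylMeasure at h1 h2 ⊢
  rw [integral_prod_symm _ h1, integral_prod_symm _ h2, ← integral_neg]
  congr 1
  ext θ
  obtain ⟨ε, hε, H⟩ := hφ.compactSupport
  have h0 : φ (0, θ) = 0 := by
    by_contra h
    linarith [(H _ _ h).1]
  have h1' : φ (1, θ) = 0 := by
    by_contra h
    linarith [(H _ _ h).2]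
  obtain ⟨C, hC⟩ := hS.bdd (i + 1) 1
  have := integral_deriv_mul_eq_neg zero_le_one (hasDerivAt_partialT hφ.smooth · θ)
    (by have := hφ.partialT.smooth.continuous; fun_prop) (hS.cont i hi) (hS.deriv i hi)
    (integrableOn_of_measurable_of_bound (hS.meas (i + 1)) (C := C)
      fun x hx => hC x (abs_le.2 ⟨by linarith [hx.1], hx.2⟩)) (by rw [h0, h1', zero_mul, zero_mul])
  simp only [← mul_assoc]
  rw [integral_mul_const, integral_mul_const, this, neg_mul]

theorem integral_partialTheta {ℓ : ℕ} {G : ℕ → ℝ → ℝ} (hG : RightDerivChain ℓ G)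
    (hper : ∀ i x, G i (x + 2 * Real.pi) = G i x) {f : ℝ → ℝ}
    (hf : Measurable f) (hfb : ∀ R, ∃ C, ∀ x, |x| ≤ R → |f x| ≤ C) {φ : ℝ × ℝ → ℝ}
    (hφ : IsTestFunction φ) {i : ℕ} (hi : i < ℓ) :
    ∫ p, partialTheta φ p * (f p.1 * G i p.2) ∂cylMeasure =
      -∫ p, φ p * (f p.1 * G (i + 1) p.2) ∂cylMeasure := by
  have h1 := integrable_mul_tensor hφ.partialTheta.smooth.continuous hf (hG.meas i) hfb (hG.bdd i)
  have h2 := integrable_mul_tensor hφ.smooth.continuous hf (hG.meas (i + 1)) hfb (hG.bdd (i + 1))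
  unfold cylMeasure at h1 h2 ⊢
  rw [integral_prod _ h1, integral_prod _ h2, ← integral_neg]
  congr 1
  ext t
  have hpi := Real.pi_pos
  have hp1 := hper i 0
  have hp2 := hφ.periodic t 0
  rw [zero_add] at hp1 hp2
  obtain ⟨C, hC⟩ := hG.bdd (i + 1) (2 * Real.pi)
  have := integral_deriv_mul_eq_neg (a := 0) (b := 2 * Real.pi) (by positivity)
    (hasDerivAt_partialTheta hφ.smooth t ·)
    (by have := hφ.partialTheta.smooth.continuous; fun_prop) (hG.cont i hi) (hG.deriv i hi)
    (integrableOn_of_measurable_of_bound (hG.meas (i + 1)) (C := C)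
      fun x hx => hC x (abs_le.2 ⟨by linarith [hx.1], hx.2⟩)) (by rw [hp1, hp2])
  rw [← integral_Icc_eq_integral_Ioc, ← integral_Icc_eq_integral_Ioc]
  simp only [mul_left_comm _ (f t)]
  rw [integral_const_mul, integral_const_mul, this, mul_neg]

theorem integral_mixedPartial {k ℓ : ℕ} {S G : ℕ → ℝ → ℝ} (hS : RightDerivChain k S)
    (hG : RightDerivChain ℓ G) (hper : ∀ i x, G i (x + 2 * Real.pi) = G i x)
    {φ : ℝ × ℝ → ℝ} (hφ : IsTestFunction φ) {a b : ℕ} (ha : a ≤ k) (hb : b ≤ ℓ) :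
    ∫ p, mixedPartial a b φ p * (S 0 p.1 * G 0 p.2) ∂cylMeasure =
      (-1) ^ (a + b) * ∫ p, φ p * (S a p.1 * G b p.2) ∂cylMeasure := by
  have hT : ∀ a ≤ k, ∀ ψ, IsTestFunction ψ → ∀ b,
      ∫ p, partialT^[a] ψ p * (S 0 p.1 * G b p.2) ∂cylMeasure =
        (-1) ^ a * ∫ p, ψ p * (S a p.1 * G b p.2) ∂cylMeasure := by
    intro a ha
    induction a with
    | zero => intro ψ _ b; simp
    | succ a ih =>
      intro ψ hψ b
      rw [Function.iterate_succ_apply, ih (by omega) _ hψ.partialT,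
        integral_partialT hS (hG.meas b) (hG.bdd b) hψ (by omega)]
      ring
  have hΘ : ∀ b ≤ ℓ, ∀ ψ, IsTestFunction ψ →
      ∫ p, partialTheta^[b] ψ p * (S a p.1 * G 0 p.2) ∂cylMeasure =
        (-1) ^ b * ∫ p, ψ p * (S a p.1 * G b p.2) ∂cylMeasure := by
    intro b hb
    induction b with
    | zero => intro ψ _; simp
    | succ b ih =>
      intro ψ hψ
      rw [Function.iterate_succ_apply, ih (by omega) _ hψ.partialTheta,
        integral_partialTheta hG hper (hS.meas a) (hS.bdd a) hψ (by omega)]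
      ring
  have htest : IsTestFunction (partialTheta^[b] φ) := by
    clear hb hΘ
    induction b with
    | zero => exact hφ
    | succ b ih => rw [Function.iterate_succ_apply']; exact ih.partialTheta
  rw [mixedPartial, hT a ha _ htest, hΘ b hb _ hφ]
  ring

section

variable {E : Type*} [NormedAddCommGroup E] [InnerProductSpace ℝ E]

theorem memLp_tensor {f g : ℝ → ℝ} (hf : Measurable f) (hg : Measurable g)
    (hfb : ∀ R, ∃ C, ∀ x, |x| ≤ R → |f x| ≤ C) (hgb : ∀ R, ∃ C, ∀ x, |x| ≤ R → |g x| ≤ C) (e : E) :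
    MemLp (fun p : ℝ × ℝ => (f p.1 * g p.2) • e) 2 cylMeasure := by
  obtain ⟨C, hC⟩ := ae_bound_tensor hfb hgb
  refine MemLp.of_bound ((aestronglyMeasurable_tensor hf hg).smul_const e) (C * ‖e‖) ?_
  filter_upwards [hC] with p hp
  rw [norm_smul]
  gcongr

/-- Tensor products of functions with sufficiently many derivatives lie in `H^{k,ℓ}`. -/
theorem exists_mixedSobolev_tensor [FiniteDimensional ℝ E] {k ℓ : ℕ} {S G : ℕ → ℝ → ℝ}
    (hS : RightDerivChain k S) (hG : RightDerivChain ℓ G)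
    (hper : ∀ i x, G i (x + 2 * Real.pi) = G i x) (e : E) :
    ∃ u : MixedSobolev E k ℓ, ∀ a b : Fin 2, (u : PiLp 2 fun _ : Fin 2 × Fin 2 => CylL2 E) (a, b)
      =ᵐ[cylMeasure] fun p => (S (a * k) p.1 * G (b * ℓ) p.2) • e := by
  have hmem := fun i j => memLp_tensor (hS.meas i) (hG.meas j) (hS.bdd i) (hG.bdd j) e
  let v : PiLp 2 fun _ : Fin 2 × Fin 2 => CylL2 E :=
    WithLp.toLp 2 fun q => (hmem ((q.1 : ℕ) * k) ((q.2 : ℕ) * ℓ)).toLp _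
  have hv : ∀ a b : Fin 2, v (a, b) =ᵐ[cylMeasure] fun p => (S (a * k) p.1 * G (b * ℓ) p.2) • e :=
    fun a b => (hmem ((a : ℕ) * k) ((b : ℕ) * ℓ)).coeFn_toLp
  refine ⟨⟨v, fun a b φ hφ => ?_⟩, hv⟩
  have h0 := hv 0 0
  simp only [Fin.val_zero, zero_mul] at h0
  have e1 : ∫ p, mixedPartial (a * k) (b * ℓ) φ p • v (0, 0) p ∂cylMeasure =
      ∫ p, (mixedPartial (a * k) (b * ℓ) φ p * (S 0 p.1 * G 0 p.2)) • e ∂cylMeasure := by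
    refine integral_congr_ae ?_
    filter_upwards [h0] with p hp
    rw [hp, smul_smul]
  have e2 : ∫ p, φ p • v (a, b) p ∂cylMeasure =
      ∫ p, (φ p * (S (a * k) p.1 * G (b * ℓ) p.2)) • e ∂cylMeasure := by
    refine integral_congr_ae ?_
    filter_upwards [hv a b] with p hp
    rw [hp, smul_smul]
  have hle : ∀ (c : Fin 2) (m : ℕ), (c : ℕ) * m ≤ m := fun c m =>
    (Nat.mul_le_mul_right m (Nat.lt_succ_iff.1 c.2)).trans (one_mul m).le
  rw [e1, e2, integral_smul_const, integral_smul_const,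
    integral_mixedPartial hS hG hper hφ (hle a k) (hle b ℓ), smul_smul]

/-- A uniform bound on all derivatives bounds the norm of `H^{k,ℓ}`. -/
theorem exists_norm_sub_le_of_ae_bound [FiniteDimensional ℝ E] (k ℓ : ℕ) :
    ∃ K : ℝ, 0 < K ∧ ∀ (u v : MixedSobolev E k ℓ) (ε : ℝ), 0 ≤ ε →
      (∀ q, ∀ᵐ p ∂cylMeasure, ‖(u : PiLp 2 fun _ : Fin 2 × Fin 2 => CylL2 E) q p -
        (v : PiLp 2 fun _ : Fin 2 × Fin 2 => CylL2 E) q p‖ ≤ ε) → ‖u - v‖ ≤ K * ε := by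
  set A : ℝ := measureUnivNNReal cylMeasure ^ ((2 : ℝ≥0∞).toReal)⁻¹ with hA
  have hA0 : 0 ≤ A := by positivity
  refine ⟨2 * A + 1, by positivity, fun u v ε hε H => ?_⟩
  have hq : ∀ q, ‖((u - v : MixedSobolev E k ℓ) : PiLp 2 fun _ : Fin 2 × Fin 2 => CylL2 E) q‖ ≤
      A * ε := by
    intro q
    refine Lp.norm_le_of_ae_bound hε ?_
    filter_upwards [H q, Lp.coeFn_sub ((u : PiLp 2 fun _ : Fin 2 × Fin 2 => CylL2 E) q)
      ((v : PiLp 2 fun _ : Fin 2 × Fin 2 => CylL2 E) q)] with p hp hp'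
    rw [Submodule.coe_sub, PiLp.sub_apply, hp']
    exact hp
  rw [← Submodule.norm_coe, PiLp.norm_eq_of_L2]
  calc _ ≤ √(∑ _q : Fin 2 × Fin 2, (A * ε) ^ 2) := by
        refine Real.sqrt_le_sqrt (Finset.sum_le_sum fun q _ => ?_)
        have := hq q
        gcongr
    _ = 2 * A * ε := by
        rw [Finset.sum_const, Finset.card_univ, Fintype.card_prod, Fintype.card_fin, nsmul_eq_mul,
          show ((2 * 2 : ℕ) : ℝ) * (A * ε) ^ 2 = (2 * A * ε) ^ 2 by push_cast; ring,
          Real.sqrt_sq (by positivity)]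
    _ ≤ (2 * A + 1) * ε := by nlinarith

end

/-! ### Approximation of smooth tensor products -/

/-- The derivatives of the polynomial function of `q`. -/
noncomputable def polyChain (q : Polynomial ℝ) (i : ℕ) (x : ℝ) : ℝ :=
  (Polynomial.derivative^[i] q).eval x

/-- The derivatives of `cos (m θ + c)`. -/
noncomputable def trigChain (m : ℕ) (c : ℝ) (i : ℕ) (θ : ℝ) : ℝ :=
  m ^ i * Real.cos (m * θ + c + i * (Real.pi / 2))

theorem derivChain_polyChain (q : Polynomial ℝ) : DerivChain (polyChain q) := by
  intro i x
  unfold polyChain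
  rw [Function.iterate_succ_apply']
  exact Polynomial.hasDerivAt _ x

theorem derivChain_trigChain (m : ℕ) (c : ℝ) : DerivChain (trigChain m c) := by
  intro i θ
  unfold trigChain
  have h1 : HasDerivAt (fun θ : ℝ => m * θ + c + i * (Real.pi / 2)) m θ := by
    simpa using (((hasDerivAt_id θ).const_mul (m : ℝ)).add_const c).add_const (i * (Real.pi / 2))
  refine (h1.cos.const_mul ((m : ℝ) ^ i)).congr_deriv ?_
  rw [show (m * θ + c + ((i + 1 : ℕ) : ℝ) * (Real.pi / 2)) =
    m * θ + c + i * (Real.pi / 2) + Real.pi / 2 by push_cast; ring, Real.cos_add_pi_div_two]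
  ring

theorem trigChain_add_period (m : ℕ) (c : ℝ) (i : ℕ) (θ : ℝ) :
    trigChain m c i (θ + 2 * Real.pi) = trigChain m c i θ := by
  unfold trigChain
  rw [show m * (θ + 2 * Real.pi) + c + i * (Real.pi / 2) =
    m * θ + c + i * (Real.pi / 2) + m * (2 * Real.pi) by ring, Real.cos_add_nat_mul_two_pi]

theorem DerivChain.eventually_splineChain {F : ℕ → ℝ → ℝ} (hF : DerivChain F) (n : ℕ) (R : ℝ)
    {ε : ℝ} (hε : 0 < ε) (I : Fin 2 → ℕ) :
    ∀ᶠ h in 𝓝[>] (0 : ℝ), ∀ a x, |x| ≤ R → |splineChain n h F (I a) x - F (I a) x| ≤ ε := by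
  refine eventually_all.2 fun a => ?_
  obtain ⟨δ, hδ, H⟩ := hF.tendsto_splineChain n (I a) R hε
  filter_upwards [Ioo_mem_nhdsGT hδ] with h hh using H h hh.1 hh.2

theorem tendsto_const_div_nat_nhdsGT {c : ℝ} (hc : 0 < c) :
    Tendsto (fun N : ℕ => c / (N : ℝ)) atTop (𝓝[>] 0) := by
  refine tendsto_nhdsWithin_iff.2 ⟨tendsto_const_div_atTop_nhds_zero_nat c, ?_⟩
  filter_upwards [eventually_gt_atTop 0] with N hN
  have : (0 : ℝ) < N := by exact_mod_cast hN
  exact div_pos hc this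

section

variable {E : Type*} [NormedAddCommGroup E] [InnerProductSpace ℝ E]

theorem tensor_splineChain_eq_tensorSpline {nt nθ Nt Nθ : ℕ} (ht : 0 < Nt) (hθ : 0 < Nθ)
    {F G : ℕ → ℝ → ℝ} (hper : ∀ x, G 0 (x + 2 * Real.pi) = G 0 x) (e : E) :
    ∃ c, (fun p : ℝ × ℝ => (splineChain nt (1 / Nt) F 0 p.1 *
        splineChain nθ (2 * Real.pi / Nθ) G 0 p.2) • e) =ᵐ[cylMeasure]
      tensorSpline nt nθ Nt Nθ c := by
  obtain ⟨s, hs⟩ := exists_quasiInterp_eq_splineB nt ht (F 0)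
  refine ⟨fun i j => (s i * G 0 (2 * Real.pi / Nθ * ((j : ℕ) - nθ))) • e, ?_⟩
  have h1 : ∀ᵐ p ∂cylMeasure, p.1 ≠ 1 := by
    have : ∀ᵐ t ∂(volume.restrict (Icc (0 : ℝ) 1)), t ≠ 1 := ae_restrict_of_ae (by simp [ae_iff])
    exact Measure.quasiMeasurePreserving_fst.ae this
  filter_upwards [ae_cylMeasure_mem, h1] with p hp hp1
  have e1 : splineChain nt (1 / Nt) F 0 p.1 = ∑ i, s i * splineB nt Nt i p.1 :=
    hs p.1 ⟨hp.1.1, lt_of_le_of_ne hp.1.2 hp1⟩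
  have e2 : splineChain nθ (2 * Real.pi / Nθ) G 0 p.2 =
      ∑ j : Fin Nθ, G 0 (2 * Real.pi / Nθ * ((j : ℕ) - nθ)) * splineC nθ Nθ j p.2 :=
    quasiInterp_eq_splineC nθ hθ hper p.2
  rw [e1, e2, Finset.sum_mul_sum, tensorSpline, Finset.sum_smul]
  refine Finset.sum_congr rfl fun i _ => ?_
  rw [Finset.sum_smul]
  refine Finset.sum_congr rfl fun j _ => ?_
  rw [smul_smul]
  congr 1
  ring

variable [FiniteDimensional ℝ E]

theorem norm_sub_splineProj_le {k ℓ nt nθ Nt Nθ : ℕ} (u : MixedSobolev E k ℓ)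
    {s : MixedSobolev E k ℓ} (hs : s ∈ splineSpace E k ℓ nt nθ Nt Nθ) :
    ‖u - splineProj E k ℓ nt nθ Nt Nθ u‖ ≤ ‖u - s‖ := by
  unfold splineProj
  rw [Submodule.starProjection_minimal]
  exact ciInf_le ⟨0, by rintro _ ⟨x, rfl⟩; exact norm_nonneg _⟩
    (⟨s, hs⟩ : splineSpace E k ℓ nt nθ Nt Nθ)

/-- Smooth tensor products are approximated by tensor products of quasi-interpolants. -/
theorem tendsto_splineProj_tensor {k ℓ nt nθ : ℕ} (hk : k ≤ nt) (hℓ : ℓ ≤ nθ)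
    {F G : ℕ → ℝ → ℝ} (hF : DerivChain F) (hG : DerivChain G)
    (hper : ∀ x, G 0 (x + 2 * Real.pi) = G 0 x) (e : E) {u : MixedSobolev E k ℓ}
    (hu : ∀ a b : Fin 2, (u : PiLp 2 fun _ : Fin 2 × Fin 2 => CylL2 E) (a, b)
      =ᵐ[cylMeasure] fun p => (F (a * k) p.1 * G (b * ℓ) p.2) • e) :
    Tendsto (fun N : ℕ × ℕ => ‖u - splineProj E k ℓ nt nθ N.1 N.2 u‖) atTop (𝓝 0) := by
  obtain ⟨K, hK, HK⟩ := exists_norm_sub_le_of_ae_bound (E := E) k ℓ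
  have hbd : ∀ {F : ℕ → ℝ → ℝ}, DerivChain F → ∀ n : ℕ,
      ∃ C, 0 ≤ C ∧ ∀ (a : Fin 2) x, |x| ≤ 2 * Real.pi → |F (a * n) x| ≤ C := by
    intro F hF n
    choose C hC using fun a : Fin 2 =>
      exists_bound_of_continuous (hF.continuous (a * n)) (2 * Real.pi)
    have hpos : ∀ a, 0 ≤ C a := fun a =>
      (abs_nonneg _).trans (hC a 0 (by rw [abs_zero]; positivity))
    exact ⟨∑ a, C a, Finset.sum_nonneg fun a _ => hpos a, fun a x hx => (hC a x hx).trans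
      (Finset.single_le_sum (fun a _ => hpos a) (Finset.mem_univ a))⟩
  obtain ⟨C, hC0, hC⟩ := hbd hF k
  obtain ⟨D, hD0, hD⟩ := hbd hG ℓ
  set B : ℝ := K * ((C + D + 1) * ‖e‖) with hB
  have hB0 : 0 ≤ B := by positivity
  rw [Metric.tendsto_nhds]
  intro ε hε
  set η : ℝ := min 1 (ε / (B + 1)) with hη
  have hη0 : 0 < η := lt_min one_pos (by positivity)
  have hη1 : η ≤ 1 := min_le_left _ _
  have hη2 : B * η < ε := by
    have : η * (B + 1) ≤ ε := (le_div_iff₀ (by positivity)).1 (min_le_right _ _)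
    nlinarith
  have ev1 := (tendsto_const_div_nat_nhdsGT one_pos).eventually
    (hF.eventually_splineChain nt (2 * Real.pi) hη0 (fun a => a * k))
  have ev2 := (tendsto_const_div_nat_nhdsGT (c := 2 * Real.pi) (by positivity)).eventually
    (hG.eventually_splineChain nθ (2 * Real.pi) hη0 (fun a => a * ℓ))
  rw [← prod_atTop_atTop_eq]
  filter_upwards [prod_mem_prod (ev1.and (eventually_gt_atTop 0))
    (ev2.and (eventually_gt_atTop 0))] with N hN
  obtain ⟨⟨h1, hN1⟩, h2, hN2⟩ := hN
  have hN1' : (0 : ℝ) < N.1 := by exact_mod_cast hN1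
  have hN2' : (0 : ℝ) < N.2 := by exact_mod_cast hN2
  obtain ⟨s, hs⟩ := exists_mixedSobolev_tensor (E := E)
    (rightDerivChain_splineChain hk (h := 1 / (N.1 : ℝ)) (by positivity) hF)
    (rightDerivChain_splineChain hℓ (h := 2 * Real.pi / (N.2 : ℝ)) (by positivity) hG)
    (splineChain_add_period nθ (T := 2 * Real.pi) (by positivity)
      (by field_simp : 2 * Real.pi = 2 * Real.pi / (N.2 : ℝ) * N.2) hper) e
  have hmem : s ∈ splineSpace E k ℓ nt nθ N.1 N.2 := by
    obtain ⟨c, hc⟩ := tensor_splineChain_eq_tensorSpline (nt := nt) (nθ := nθ) hN1 hN2 (F := F)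
      hper e
    have h0 := hs 0 0
    simp only [Fin.val_zero, zero_mul] at h0
    exact ⟨c, h0.trans hc⟩
  rw [dist_zero_right, norm_norm]
  refine (norm_sub_splineProj_le u hmem).trans_lt (lt_of_le_of_lt ?_ hη2)
  refine (HK u s ((C + D + 1) * η * ‖e‖) (by positivity) fun q => ?_).trans_eq (by rw [hB]; ring)
  obtain ⟨a, b⟩ := q
  filter_upwards [hu a b, hs a b, ae_cylMeasure_mem] with p hp1 hp2 hp3
  obtain ⟨hp4, hp5⟩ := abs_le_of_mem_cyl hp3
  rw [hp1, hp2, ← sub_smul, norm_smul]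
  refine mul_le_mul_of_nonneg_right ?_ (norm_nonneg e)
  have i1 := h1 a p.1 hp4
  have i2 := h2 b p.2 hp5
  have i3 := hC a p.1 hp4
  have i4 := hD b p.2 hp5
  set x := F (a * k) p.1
  set y := G (b * ℓ) p.2
  set x' := splineChain nt (1 / (N.1 : ℝ)) F (a * k) p.1
  set y' := splineChain nθ (2 * Real.pi / (N.2 : ℝ)) G (b * ℓ) p.2
  have i5 : x * y - x' * y' = -((x' - x) * y + x * (y' - y) + (x' - x) * (y' - y)) := by ring
  rw [i5, norm_neg]
  calc _ ≤ |(x' - x) * y| + |x * (y' - y)| + |(x' - x) * (y' - y)| := abs_add_three _ _ _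
    _ ≤ η * D + C * η + η * 1 := by
      simp only [abs_mul]
      gcongr
      exact i2.trans hη1
    _ = (C + D + 1) * η := by ring

/-- The convergence of the projections is inherited by the closed linear span. -/
theorem tendsto_splineProj_of_dense {k ℓ nt nθ : ℕ} {T : Set (MixedSobolev E k ℓ)}
    (hT : ∀ u ∈ T, Tendsto (fun N : ℕ × ℕ => ‖u - splineProj E k ℓ nt nθ N.1 N.2 u‖) atTop (𝓝 0))
    (hperp : ∀ u : MixedSobolev E k ℓ, (∀ v ∈ T, inner ℝ v u = 0) → u = 0)
    (c : MixedSobolev E k ℓ) :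
    Tendsto (fun N : ℕ × ℕ => ‖c - splineProj E k ℓ nt nθ N.1 N.2 c‖) atTop (𝓝 0) := by
  have hspan : ∀ u ∈ Submodule.span ℝ T,
      Tendsto (fun N : ℕ × ℕ => ‖u - splineProj E k ℓ nt nθ N.1 N.2 u‖) atTop (𝓝 0) := by
    intro u hu
    simp only [← tendsto_zero_iff_norm_tendsto_zero] at hT ⊢
    induction hu using Submodule.span_induction with
    | mem u hu => exact hT u hu
    | zero => simp
    | add u v _ _ hu hv =>
      simpa [add_sub_add_comm] using hu.add hv
    | smul r u _ hu =>
      simpa [smul_sub] using hu.const_smul r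
  have hdense : (Submodule.span ℝ T).topologicalClosure = ⊤ := by
    rw [Submodule.topologicalClosure_eq_top_iff, Submodule.eq_bot_iff]
    intro u hu
    exact hperp u fun v hv => (Submodule.mem_orthogonal _ _).1 hu v (Submodule.subset_span hv)
  rw [Metric.tendsto_nhds]
  intro ε hε
  have hc : c ∈ closure (Submodule.span ℝ T : Set (MixedSobolev E k ℓ)) := by
    rw [← Submodule.topologicalClosure_coe, hdense]
    trivial
  obtain ⟨u, hu, hcu⟩ := Metric.mem_closure_iff.1 hc (ε / 2) (half_pos hε)
  filter_upwards [(Metric.tendsto_nhds.1 (hspan u hu)) (ε / 2) (half_pos hε)] with N hN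
  rw [dist_zero_right, norm_norm] at hN ⊢
  have hmem : splineProj E k ℓ nt nθ N.1 N.2 u ∈ splineSpace E k ℓ nt nθ N.1 N.2 :=
    Submodule.starProjection_apply_mem _ _
  calc _ ≤ ‖c - splineProj E k ℓ nt nθ N.1 N.2 u‖ := norm_sub_splineProj_le c hmem
    _ ≤ ‖c - u‖ + ‖u - splineProj E k ℓ nt nθ N.1 N.2 u‖ := norm_sub_le_norm_sub_add_norm_sub _ _ _
    _ < ε := by rw [← dist_eq_norm c u]; linarith

end

/-! ### The Sobolev space of the interval -/

/-- Smooth functions with compact support in `(0,1)`. -/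
structure IsIntervalTestFunction (φ : ℝ → ℝ) : Prop where
  smooth : ContDiff ℝ ∞ φ
  compactSupport : ∃ ε > 0, ∀ t, φ t ≠ 0 → ε ≤ t ∧ t ≤ 1 - ε

namespace IsIntervalTestFunction

variable {φ ψ : ℝ → ℝ}

theorem hasDerivAt (h : IsIntervalTestFunction φ) (t : ℝ) : HasDerivAt φ (deriv φ t) t :=
  ((h.smooth.differentiable (by simp)) t).hasDerivAt

theorem deriv (h : IsIntervalTestFunction φ) : IsIntervalTestFunction (deriv φ) where
  smooth := (contDiff_infty_iff_deriv.1 h.smooth).2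
  compactSupport := by
    obtain ⟨ε, hε, H⟩ := h.compactSupport
    refine ⟨ε, hε, fun t hne => ?_⟩
    by_contra hcon
    refine hne ((h.hasDerivAt t).unique
      ((hasDerivAt_const t (0 : ℝ)).congr_of_eventuallyEq ?_))
    rw [not_and_or, not_le, not_le] at hcon
    rcases hcon with hcon | hcon
    · filter_upwards [Iio_mem_nhds hcon] with s hs
      by_contra h0
      exact absurd (H s h0).1 (not_le.2 hs)
    · filter_upwards [Ioi_mem_nhds hcon] with s hs
      by_contra h0
      exact absurd (H s h0).2 (not_le.2 hs)

theorem iteratedDeriv (h : IsIntervalTestFunction φ) (k : ℕ) :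
    IsIntervalTestFunction (iteratedDeriv k φ) := by
  induction k with
  | zero => simpa using h
  | succ k ih => rw [iteratedDeriv_succ]; exact ih.deriv

theorem apply_zero (h : IsIntervalTestFunction φ) : φ 0 = 0 := by
  obtain ⟨ε, hε, H⟩ := h.compactSupport
  by_contra h0
  linarith [(H _ h0).1]

theorem apply_one (h : IsIntervalTestFunction φ) : φ 1 = 0 := by
  obtain ⟨ε, hε, H⟩ := h.compactSupport
  by_contra h0
  linarith [(H _ h0).2]

theorem of_tsupport_subset (h : ContDiff ℝ ∞ φ) (hc : HasCompactSupport φ)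
    (hs : tsupport φ ⊆ Ioo 0 1) : IsIntervalTestFunction φ where
  smooth := h
  compactSupport := by
    obtain ⟨δ, hδ, H⟩ := hc.isCompact.exists_cthickening_subset_open isOpen_Ioo hs
    refine ⟨δ, hδ, fun t ht => ?_⟩
    have ht' : t ∈ tsupport φ := subset_tsupport _ ht
    have h1 := H (Metric.mem_cthickening_of_dist_le (t - δ) t δ _ ht'
      (by rw [Real.dist_eq, sub_sub_cancel_left, abs_neg, abs_of_pos hδ]))
    have h2 := H (Metric.mem_cthickening_of_dist_le (t + δ) t δ _ ht'
      (by rw [Real.dist_eq, add_sub_cancel_left, abs_of_pos hδ]))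
    exact ⟨by linarith [h1.1], by linarith [h2.2]⟩

theorem integral_eq (h : IsIntervalTestFunction φ) (r : ℝ → ℝ) :
    ∫ x, φ x * r x = ∫ x in Icc 0 1, φ x * r x := by
  obtain ⟨ε, hε, H⟩ := h.compactSupport
  refine (setIntegral_eq_integral_of_forall_compl_eq_zero fun x hx => ?_).symm
  have : φ x = 0 := by
    by_contra h0
    exact hx ⟨by linarith [(H x h0).1], by linarith [(H x h0).2]⟩
  rw [this, zero_mul]

theorem integrableOn_mul (h : IsIntervalTestFunction φ) {r : ℝ → ℝ} (hr : IntegrableOn r (Icc 0 1)) :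
    IntegrableOn (fun x => φ x * r x) (Icc 0 1) :=
  hr.continuousOn_mul h.smooth.continuous.continuousOn isCompact_Icc

/-- A test function with vanishing integral is the derivative of a test function. -/
theorem exists_deriv_eq (h : IsIntervalTestFunction ψ) (h0 : ∫ x in Icc 0 1, ψ x = 0) :
    ∃ φ, IsIntervalTestFunction φ ∧ _root_.deriv φ = ψ := by
  have hc := h.smooth.continuous
  have hd : ∀ x, HasDerivAt (fun x => ∫ y in (0 : ℝ)..x, ψ y) (ψ x) x := fun x =>
    intervalIntegral.integral_hasDerivAt_right (hc.intervalIntegrable _ _)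
      (hc.stronglyMeasurableAtFilter _ _) hc.continuousAt
  have hder : _root_.deriv (fun x => ∫ y in (0 : ℝ)..x, ψ y) = ψ := funext fun x => (hd x).deriv
  obtain ⟨ε, hε, H⟩ := h.compactSupport
  refine ⟨_, ⟨?_, ε, hε, fun t ht => ?_⟩, hder⟩
  · rw [contDiff_infty_iff_deriv, hder]
    exact ⟨fun x => (hd x).differentiableAt, h.smooth⟩
  · have hz : ∀ a b : ℝ, (∀ y ∈ uIoc a b, ψ y = 0) → ∫ y in a..b, ψ y = 0 := fun a b hab =>
      intervalIntegral.integral_zero_ae (ae_of_all _ hab)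
    by_contra hcon
    rw [not_and_or, not_le, not_le] at hcon
    have h1 : ∫ y in (0 : ℝ)..1, ψ y = 0 := by
      rw [intervalIntegral.integral_of_le zero_le_one, ← integral_Icc_eq_integral_Ioc, h0]
    rcases hcon with hcon | hcon
    · refine ht (hz 0 t fun y hy => ?_)
      by_contra hy0
      rcases mem_uIoc.1 hy with hy | hy <;> linarith [(H y hy0).1]
    · refine ht ?_
      rw [← intervalIntegral.integral_add_adjacent_intervals (hc.intervalIntegrable 0 1)
        (hc.intervalIntegrable 1 t), h1, zero_add]
      refine hz 1 t fun y hy => ?_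
      by_contra hy0
      rcases mem_uIoc.1 hy with hy | hy <;> linarith [(H y hy0).2]

end IsIntervalTestFunction

theorem exists_isIntervalTestFunction_integral_eq_one :
    ∃ η, IsIntervalTestFunction η ∧ ∫ x in Icc 0 1, η x = 1 := by
  let f : ContDiffBump (1 / 2 : ℝ) := ⟨1 / 8, 1 / 4, by norm_num, by norm_num⟩
  have hη : IsIntervalTestFunction (f.normed volume) := by
    refine .of_tsupport_subset f.contDiff_normed f.hasCompactSupport_normed ?_
    rw [f.tsupport_normed_eq, Real.closedBall_eq_Icc]
    intro x hx
    have h1 := hx.1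
    have h2 := hx.2
    simp only [f] at h1 h2
    constructor <;> linarith
  refine ⟨_, hη, ?_⟩
  have := hη.integral_eq 1
  simp only [Pi.one_apply, mul_one] at this
  rw [← this, f.integral_normed]

/-- The fundamental lemma of the calculus of variations. -/
theorem ae_eq_zero_of_forall_integral_test {r : ℝ → ℝ} (hr : IntegrableOn r (Icc 0 1))
    (h : ∀ φ, IsIntervalTestFunction φ → ∫ x in Icc 0 1, φ x * r x = 0) :
    r =ᵐ[volume.restrict (Icc 0 1)] 0 := by
  have h1 := isOpen_Ioo.ae_eq_zero_of_integral_contDiff_smul_eq_zero (μ := volume)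
    (U := Ioo (0 : ℝ) 1) (f := r) (hr.mono_set Ioo_subset_Icc_self).locallyIntegrableOn
    fun g hg hc hs => by
      have hg' := IsIntervalTestFunction.of_tsupport_subset hg hc hs
      simp only [smul_eq_mul]
      rw [hg'.integral_eq, h g hg']
  rw [← Measure.restrict_congr_set Ioo_ae_eq_Icc]
  exact (ae_restrict_iff' measurableSet_Ioo).2 h1

theorem DerivChain.integral_iteratedDeriv_mul {F : ℕ → ℝ → ℝ} (hF : DerivChain F) (k : ℕ)
    {φ : ℝ → ℝ} (hφ : IsIntervalTestFunction φ) :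
    ∫ x in Icc 0 1, iteratedDeriv k φ x * F 0 x = (-1) ^ k * ∫ x in Icc 0 1, φ x * F k x := by
  induction k generalizing φ with
  | zero => simp
  | succ k ih =>
    rw [iteratedDeriv_succ', ih hφ.deriv, integral_deriv_mul_eq_neg zero_le_one hφ.hasDerivAt
      hφ.deriv.smooth.continuous (hF.continuous k) (fun x => (hF k x).hasDerivWithinAt)
      (hF.continuous (k + 1)).continuousOn.integrableOn_Icc
      (by rw [hφ.apply_zero, hφ.apply_one, zero_mul, zero_mul])]
    ring

theorem exists_derivative_eq (q : Polynomial ℝ) :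
    ∃ Q : Polynomial ℝ, Polynomial.derivative Q = q ∧ Q.eval 0 = 0 := by
  induction q using Polynomial.induction_on' with
  | add p q hp hq =>
    obtain ⟨P, h1, h2⟩ := hp
    obtain ⟨Q, h3, h4⟩ := hq
    exact ⟨P + Q, by simp [h1, h3], by simp [h2, h4]⟩
  | monomial n a =>
    refine ⟨Polynomial.monomial (n + 1) (a / (n + 1)), ?_, by simp⟩
    rw [Polynomial.derivative_monomial]
    have : (n + 1 : ℝ) ≠ 0 := by positivity
    congr 1
    push_cast
    field_simp

/-- The antiderivative vanishing at `0`. -/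
noncomputable def primitive (w : ℝ → ℝ) (x : ℝ) : ℝ := ∫ y in (0 : ℝ)..x, w y

theorem exists_polynomial_eq_primitive (k : ℕ) (q : Polynomial ℝ) :
    ∃ Q : Polynomial ℝ, Polynomial.derivative^[k] Q = q ∧
      ∀ x, Q.eval x = primitive^[k] (fun x => q.eval x) x := by
  induction k with
  | zero => exact ⟨q, rfl, fun x => rfl⟩
  | succ k ih =>
    obtain ⟨Q, h1, h2⟩ := ih
    obtain ⟨R, h3, h4⟩ := exists_derivative_eq Q
    refine ⟨R, by rw [Function.iterate_succ_apply, h3, h1], fun x => ?_⟩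
    rw [Function.iterate_succ_apply', ← funext h2, primitive,
      intervalIntegral.integral_eq_sub_of_hasDerivAt (f := fun x => R.eval x)
        (fun x _ => by simpa [h3] using R.hasDerivAt x)
        (Q.continuous.intervalIntegrable _ _), h4, sub_zero]

theorem continuous_primitive {w : ℝ → ℝ} (hw : ∀ a b, IntervalIntegrable w volume a b) :
    Continuous (primitive w) :=
  intervalIntegral.continuous_primitive hw 0

theorem intervalIntegrable_iterate_primitive {w : ℝ → ℝ}
    (hw : ∀ a b, IntervalIntegrable w volume a b) (k : ℕ) (a b : ℝ) :
    IntervalIntegrable (primitive^[k] w) volume a b := by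
  induction k generalizing a b with
  | zero => exact hw a b
  | succ k ih =>
    rw [Function.iterate_succ_apply']
    exact (continuous_primitive ih).intervalIntegrable a b

theorem iterate_primitive_sub {w d : ℝ → ℝ} (hw : ∀ a b, IntervalIntegrable w volume a b)
    (hd : ∀ a b, IntervalIntegrable d volume a b) (k : ℕ) (x : ℝ) :
    primitive^[k] (fun x => w x - d x) x = primitive^[k] w x - primitive^[k] d x := by
  induction k generalizing x with
  | zero => rfl
  | succ k ih =>
    simp only [Function.iterate_succ_apply', primitive] at ih ⊢
    simp only [ih]
    exact intervalIntegral.integral_sub (intervalIntegrable_iterate_primitive hw k 0 x)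
      (intervalIntegrable_iterate_primitive hd k 0 x)

theorem integral_iteratedDeriv_mul_primitive {w : ℝ → ℝ}
    (hw : ∀ a b, IntervalIntegrable w volume a b) (k : ℕ) {φ : ℝ → ℝ}
    (hφ : IsIntervalTestFunction φ) :
    ∫ x in Icc 0 1, iteratedDeriv k φ x * primitive^[k] w x =
      (-1) ^ k * ∫ x in Icc 0 1, φ x * w x := by
  induction k generalizing φ w with
  | zero => simp
  | succ k ih =>
    have hc := continuous_primitive hw
    rw [iteratedDeriv_succ', Function.iterate_succ_apply,
      ih (fun a b => hc.intervalIntegrable a b) hφ.deriv, pow_succ, mul_assoc]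
    congr 1
    have hac1 : AbsolutelyContinuousOnInterval φ 0 1 :=
      (hφ.smooth.of_le (by simp)).contDiffOn.absolutelyContinuousOnInterval
    have hac2 : AbsolutelyContinuousOnInterval (primitive w) 0 1 :=
      (hw 0 1).absolutelyContinuousOnInterval_intervalIntegral (c := 0) (by simp)
    have h := hac1.integral_mul_deriv_eq_deriv_mul hac2
    rw [hφ.apply_zero, hφ.apply_one, zero_mul, zero_mul, sub_self, zero_sub] at h
    have h2 : ∫ x in (0 : ℝ)..1, φ x * deriv (primitive w) x = ∫ x in (0 : ℝ)..1, φ x * w x := by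
      refine intervalIntegral.integral_congr_ae ?_
      filter_upwards [(hw 0 1).ae_hasDerivAt_integral] with x hx hx'
      have hx2 : HasDerivAt (primitive w) (w x) x := hx (uIoc_subset_uIcc hx') 0 (by simp)
      rw [hx2.deriv]
    rw [h2, intervalIntegral.integral_of_le zero_le_one,
      intervalIntegral.integral_of_le zero_le_one] at h
    rw [integral_Icc_eq_integral_Ioc, integral_Icc_eq_integral_Ioc, h, neg_one_mul, neg_neg]

/-- **Du Bois-Reymond's lemma**: a function whose `k`-th weak derivative vanishes is a polynomial of
degree less than `k`. -/
theorem exists_polynomial_of_weak_iteratedDeriv_eq_zero (k : ℕ) {r : ℝ → ℝ}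
    (hr : IntegrableOn r (Icc 0 1))
    (h : ∀ φ, IsIntervalTestFunction φ → ∫ x in Icc 0 1, iteratedDeriv k φ x * r x = 0) :
    ∃ p : Polynomial ℝ, Polynomial.derivative^[k] p = 0 ∧
      r =ᵐ[volume.restrict (Icc 0 1)] fun x => p.eval x := by
  induction k generalizing r with
  | zero =>
    refine ⟨0, rfl, ?_⟩
    filter_upwards [ae_eq_zero_of_forall_integral_test hr (by simpa using h)] with x hx
    simpa using hx
  | succ k ih =>
    obtain ⟨η, hη, hη1⟩ := exists_isIntervalTestFunction_integral_eq_one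
    set c := ∫ x in Icc 0 1, iteratedDeriv k η x * r x with hc
    obtain ⟨P, hP, -⟩ := exists_polynomial_eq_primitive k (Polynomial.C ((-1) ^ k * c))
    have hPint : IntegrableOn (fun x => P.eval x) (Icc 0 1) :=
      P.continuous.continuousOn.integrableOn_Icc
    have key : ∀ ψ, IsIntervalTestFunction ψ →
        ∫ x in Icc 0 1, iteratedDeriv k ψ x * (r x - P.eval x) = 0 := by
      intro ψ hψ
      set I := ∫ x in Icc 0 1, ψ x with hI
      -- subtracting a multiple of `η` makes the integral of `ψ` vanish
      have hχ : IsIntervalTestFunction fun x => ψ x - I * η x := by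
        obtain ⟨ε, hε, H⟩ := hψ.compactSupport
        obtain ⟨δ, hδ, H'⟩ := hη.compactSupport
        refine ⟨hψ.smooth.sub (contDiff_const.mul hη.smooth), min ε δ, lt_min hε hδ, fun t ht => ?_⟩
        by_cases h0 : ψ t = 0
        · have h1 := H' t fun h1 => ht (by rw [h0, h1, mul_zero, sub_zero])
          have := min_le_right ε δ
          exact ⟨by linarith [h1.1], by linarith [h1.2]⟩
        · have h1 := H t h0
          have := min_le_left ε δ
          exact ⟨by linarith [h1.1], by linarith [h1.2]⟩
      obtain ⟨φ, hφ, hφd⟩ := hχ.exists_deriv_eq (by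
        have hηi : IntegrableOn η (Icc 0 1) := hη.smooth.continuous.continuousOn.integrableOn_Icc
        rw [integral_sub hψ.smooth.continuous.continuousOn.integrableOn_Icc (hηi.const_mul I),
          integral_const_mul, hη1, mul_one, sub_self])
      have h1 := h φ hφ
      rw [iteratedDeriv_succ', hφd] at h1
      have h2 : ∀ x, iteratedDeriv k (fun x => ψ x - I * η x) x =
          iteratedDeriv k ψ x - I * iteratedDeriv k η x := by
        intro x
        have hs1 : ContDiffAt ℝ k ψ x := (contDiff_infty.1 hψ.smooth k).contDiffAt
        have hs2 : ContDiffAt ℝ k η x := (contDiff_infty.1 hη.smooth k).contDiffAt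
        rw [iteratedDeriv_fun_sub hs1 (contDiffAt_const.mul hs2), iteratedDeriv_const_mul_field]
      simp only [h2, sub_mul, mul_assoc] at h1
      rw [integral_sub ((hψ.iteratedDeriv k).integrableOn_mul hr)
        (((hη.iteratedDeriv k).integrableOn_mul hr).const_mul I), integral_const_mul, ← hc] at h1
      have h3 := (derivChain_polyChain P).integral_iteratedDeriv_mul k hψ
      simp only [polyChain, hP, Function.iterate_zero, id, Polynomial.eval_C] at h3
      rw [integral_mul_const, ← hI] at h3
      simp only [mul_sub]
      rw [integral_sub ((hψ.iteratedDeriv k).integrableOn_mul hr)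
        ((hψ.iteratedDeriv k).integrableOn_mul hPint), h3]
      have h4 : ((-1 : ℝ) ^ k) * (-1) ^ k = 1 := by rw [← mul_pow]; simp
      linear_combination h1 - I * c * h4
    obtain ⟨p, hp, hp'⟩ := ih (hr.sub hPint) key
    refine ⟨p + P, ?_, ?_⟩
    · rw [Function.iterate_succ_apply', iterate_map_add, hp, hP]
      simp
    · filter_upwards [hp'] with x hx
      rw [Polynomial.eval_add, ← hx, Pi.sub_apply, sub_add_cancel]

theorem sq_integral_le_measure_mul {α : Type*} [MeasurableSpace α] {μ : Measure α}
    [IsFiniteMeasure μ] {f : α → ℝ} (hf : MemLp f 2 μ) :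
    (∫ x, f x ∂μ) ^ 2 ≤ μ.real univ * ∫ x, f x ^ 2 ∂μ := by
  set L := μ.real univ with hL
  set A := ∫ x, f x ∂μ with hA
  have hi : Integrable f μ := hf.integrable one_le_two
  have hi2 := hf.integrable_sq
  have h0 : 0 ≤ ∫ x, (L * f x - A) ^ 2 ∂μ := integral_nonneg fun x => sq_nonneg _
  have h1 : ∫ x, (L * f x - A) ^ 2 ∂μ = L * (L * ∫ x, f x ^ 2 ∂μ - A ^ 2) := by
    have : ∀ x, (L * f x - A) ^ 2 = L ^ 2 * f x ^ 2 - 2 * L * A * f x + A ^ 2 := fun x => by ring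
    simp only [this]
    have hi3 : Integrable (fun x => L ^ 2 * f x ^ 2 - 2 * L * A * f x) μ :=
      (hi2.const_mul _).sub (hi.const_mul _)
    rw [integral_add hi3 (integrable_const _), integral_sub (hi2.const_mul _) (hi.const_mul _),
      integral_const_mul, integral_const_mul,
      integral_const, ← hA, ← hL, smul_eq_mul]
    ring
  rw [h1] at h0
  rcases (measureReal_nonneg : 0 ≤ μ.real univ).lt_or_eq with hpos | hzero
  · have := nonneg_of_mul_nonneg_right h0 hpos
    linarith
  · have hμ : μ = 0 := by
      rwa [eq_comm, measureReal_eq_zero_iff, Measure.measure_univ_eq_zero] at hzero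
    simp [hA, hμ]

theorem memLp_of_continuous {f : ℝ → ℝ} (hf : Continuous f) (a b : ℝ) :
    MemLp f 2 (volume.restrict (Icc a b)) := by
  obtain ⟨C, hC⟩ := (isCompact_Icc (a := a) (b := b)).exists_bound_of_continuousOn hf.continuousOn
  exact MemLp.of_bound hf.aestronglyMeasurable C
    ((ae_restrict_iff' measurableSet_Icc).2 (ae_of_all _ hC))

/-- Integration from `0` is a contraction of `L²(0,1)`. -/
theorem integral_sq_iterate_primitive_le {d : ℝ → ℝ} (hd : ∀ a b, IntervalIntegrable d volume a b)
    (hd2 : MemLp d 2 (volume.restrict (Icc 0 1))) (k : ℕ) :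
    MemLp (primitive^[k] d) 2 (volume.restrict (Icc 0 1)) ∧
      ∫ x in Icc 0 1, primitive^[k] d x ^ 2 ≤ ∫ x in Icc 0 1, d x ^ 2 := by
  induction k with
  | zero => exact ⟨hd2, le_rfl⟩
  | succ k ih =>
    rw [Function.iterate_succ_apply']
    set g := primitive^[k] d
    have hg := intervalIntegrable_iterate_primitive hd k
    have hm := memLp_of_continuous (continuous_primitive hg) 0 1
    refine ⟨hm, le_trans ?_ ih.2⟩
    have hgi : IntegrableOn g (Icc 0 1) := ih.1.integrable one_le_two
    have hpt : ∀ x ∈ Icc (0 : ℝ) 1, primitive g x ^ 2 ≤ ∫ x in Icc 0 1, g x ^ 2 := by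
      intro x hx
      have h1 : |primitive g x| ≤ ∫ x in Icc 0 1, |g x| := by
        refine (intervalIntegral.abs_integral_le_integral_abs hx.1).trans ?_
        rw [intervalIntegral.integral_of_le hx.1]
        exact setIntegral_mono_set hgi.abs (ae_of_all _ fun x => abs_nonneg _)
          (Ioc_subset_Icc_self.trans (Icc_subset_Icc_right hx.2)).eventuallyLE
      have h2 := sq_integral_le_measure_mul ih.1.abs
      simp only [Pi.abs_apply, sq_abs] at h2
      rw [← sq_abs]
      refine (pow_le_pow_left₀ (abs_nonneg _) h1 2).trans (h2.trans_eq ?_)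
      simp
    refine (setIntegral_mono_on hm.integrable_sq (integrable_const _) measurableSet_Icc
      hpt).trans_eq ?_
    simp

theorem exists_polynomial_integral_sq_sub_le {w : ℝ → ℝ}
    (hw : MemLp w 2 (volume.restrict (Icc 0 1))) {ε : ℝ} (hε : 0 < ε) :
    ∃ q : Polynomial ℝ, ∫ x in Icc 0 1, (w x - q.eval x) ^ 2 ≤ ε := by
  have hw' : MemLp w (ENNReal.ofReal 2) (volume.restrict (Icc 0 1)) := by simpa using hw
  obtain ⟨g, hg, -⟩ := hw'.exists_boundedContinuous_integral_rpow_sub_le two_pos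
    (show 0 < ε / 4 by positivity)
  obtain ⟨q, hq⟩ := exists_polynomial_near_of_continuousOn 0 1 g g.continuous.continuousOn
    (√(ε / 4)) (by positivity)
  have hgL := memLp_of_continuous g.continuous 0 1
  have hqL := memLp_of_continuous q.continuous 0 1
  refine ⟨q, ?_⟩
  have h1 : ∀ x, ‖w x - g x‖ ^ (2 : ℝ) = (w x - g x) ^ 2 := fun x => by
    rw [show (2 : ℝ) = (2 : ℕ) by norm_num, Real.rpow_natCast, Real.norm_eq_abs, sq_abs]
  simp only [h1] at hg
  calc ∫ x in Icc 0 1, (w x - q.eval x) ^ 2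
      ≤ ∫ x in Icc 0 1, (2 * (w x - g x) ^ 2 + 2 * (ε / 4)) := by
        refine setIntegral_mono_on (hw.sub hqL).integrable_sq
          (((hw.sub hgL).integrable_sq.const_mul 2).add (integrable_const _)) measurableSet_Icc
          fun x hx => ?_
        have h2 : (q.eval x - g x) ^ 2 ≤ ε / 4 := by
          rw [← sq_abs, ← Real.sq_sqrt (show 0 ≤ ε / 4 by positivity)]
          exact pow_le_pow_left₀ (abs_nonneg _) (hq x hx).le 2
        nlinarith [sq_nonneg ((w x - g x) + (q.eval x - g x))]
    _ ≤ ε := by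
        have hi : Integrable (fun x => (w x - g x) ^ 2) (volume.restrict (Icc 0 1)) :=
          (hw.sub hgL).integrable_sq
        rw [integral_add (hi.const_mul 2) (integrable_const _), integral_const_mul]
        simp only [integral_const, smul_eq_mul, MeasurableSet.univ, measureReal_restrict_apply,
          univ_inter, Real.volume_real_Icc, sub_zero, zero_le_one, sup_of_le_left, one_mul]
        linarith

/-- In `H^k(0,1)` only zero is orthogonal to all polynomials: up to a polynomial of degree less than
`k`, every element is a `k`-fold primitive of its `k`-th derivative, which polynomials approximate
in `L²`. -/
theorem ae_eq_zero_of_orthogonal_polynomials (k : ℕ) {v w : ℝ → ℝ}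
    (hv : MemLp v 2 (volume.restrict (Icc 0 1))) (hw : MemLp w 2 (volume.restrict (Icc 0 1)))
    (hvw : ∀ φ, IsIntervalTestFunction φ →
      ∫ x in Icc 0 1, iteratedDeriv k φ x * v x = (-1) ^ k * ∫ x in Icc 0 1, φ x * w x)
    (horth : ∀ q : Polynomial ℝ,
      (∫ x in Icc 0 1, v x * polyChain q 0 x) + ∫ x in Icc 0 1, w x * polyChain q k x = 0) :
    v =ᵐ[volume.restrict (Icc 0 1)] 0 := by
  -- `primitive` refers to values outside `[0,1]`, where nothing is known about `w`
  set w' := (Icc (0 : ℝ) 1).indicator w with hw'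
  have hww' : w' =ᵐ[volume.restrict (Icc 0 1)] w := indicator_ae_eq_restrict measurableSet_Icc
  have hwi : IntegrableOn w (Icc 0 1) := hw.integrable one_le_two
  have hvi : IntegrableOn v (Icc 0 1) := hv.integrable one_le_two
  have hw'i : ∀ a b, IntervalIntegrable w' volume a b := fun a b =>
    ((integrable_indicator_iff measurableSet_Icc).2 hwi).intervalIntegrable
  have hw'L : MemLp w' 2 (volume.restrict (Icc 0 1)) := hw.ae_eq hww'.symm
  have hJ := (integral_sq_iterate_primitive_le hw'i hw'L k).1
  have hJi : IntegrableOn (primitive^[k] w') (Icc 0 1) := hJ.integrable one_le_two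
  obtain ⟨p, hp, hvp⟩ := exists_polynomial_of_weak_iteratedDeriv_eq_zero k (hvi.sub hJi)
    fun φ hφ => by
      simp only [Pi.sub_apply, mul_sub]
      rw [integral_sub ((hφ.iteratedDeriv k).integrableOn_mul hvi)
        ((hφ.iteratedDeriv k).integrableOn_mul hJi), hvw φ hφ,
        integral_iteratedDeriv_mul_primitive hw'i k hφ, sub_eq_zero]
      congr 1
      refine integral_congr_ae ?_
      filter_upwards [hww'] with x hx
      rw [hx]
  have hvsq : ∫ x in Icc 0 1, v x ^ 2 ≤ 0 := by
    refine le_of_forall_pos_le_add fun ε hε => ?_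
    obtain ⟨q, hq⟩ := exists_polynomial_integral_sq_sub_le hw (show 0 < ε / 2 by positivity)
    obtain ⟨Q, hQ, hQ'⟩ := exists_polynomial_eq_primitive k q
    have h0 := horth (p + Q)
    have hPk : polyChain (p + Q) k = fun x => q.eval x := by
      ext x
      rw [polyChain, iterate_map_add, hp, hQ, zero_add]
    have hqL := memLp_of_continuous q.continuous 0 1
    have hPL : MemLp (polyChain (p + Q) 0) 2 (volume.restrict (Icc 0 1)) :=
      memLp_of_continuous (p + Q).continuous 0 1
    rw [hPk] at h0
    have hdi : ∀ a b, IntervalIntegrable (fun x => w' x - q.eval x) volume a b := fun a b =>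
      (hw'i a b).sub (q.continuous.intervalIntegrable a b)
    have h1 := (integral_sq_iterate_primitive_le hdi (hw'L.sub hqL) k).2
    have h2 : ∫ x in Icc 0 1, (v x - polyChain (p + Q) 0 x) ^ 2 ≤ ε / 2 := by
      refine le_trans (le_of_eq ?_) (h1.trans (le_trans (le_of_eq ?_) hq))
      · refine integral_congr_ae ?_
        filter_upwards [hvp] with x hx
        rw [iterate_primitive_sub hw'i fun a b => q.continuous.intervalIntegrable a b]
        have hx' : v x - primitive^[k] w' x = p.eval x := hx
        simp only [polyChain, Function.iterate_zero, id, Polynomial.eval_add, hQ']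
        rw [← hx']
        ring
      · refine integral_congr_ae ?_
        filter_upwards [hww'] with x hx
        rw [hx]
    have i1 := hv.integrable_sq
    have i2 := hw.integrable_sq
    have i3 := (hv.sub hPL).integrable_sq
    have i4 := (hw.sub hqL).integrable_sq
    have i5 : Integrable (fun x => v x * polyChain (p + Q) 0 x) (volume.restrict (Icc 0 1)) :=
      hv.integrable_mul hPL
    have i6 : Integrable (fun x => w x * q.eval x) (volume.restrict (Icc 0 1)) :=
      hw.integrable_mul hqL
    have h3 : ∫ x in Icc 0 1, (v x - polyChain (p + Q) 0 x) ^ 2 ≥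
        ∫ x in Icc 0 1, (v x ^ 2 - 2 * (v x * polyChain (p + Q) 0 x)) :=
      integral_mono (i1.sub (i5.const_mul 2)) i3 fun x => by
        change v x ^ 2 - 2 * (v x * polyChain (p + Q) 0 x) ≤ (v x - polyChain (p + Q) 0 x) ^ 2
        nlinarith [sq_nonneg (polyChain (p + Q) 0 x)]
    have h4 : ∫ x in Icc 0 1, (w x - q.eval x) ^ 2 ≥
        ∫ x in Icc 0 1, (w x ^ 2 - 2 * (w x * q.eval x)) :=
      integral_mono (i2.sub (i6.const_mul 2)) i4 fun x => by
        change w x ^ 2 - 2 * (w x * q.eval x) ≤ (w x - q.eval x) ^ 2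
        nlinarith [sq_nonneg (q.eval x)]
    rw [integral_sub i1 (i5.const_mul 2), integral_const_mul] at h3
    rw [integral_sub i2 (i6.const_mul 2), integral_const_mul] at h4
    have h5 : 0 ≤ ∫ x in Icc 0 1, w x ^ 2 := integral_nonneg fun x => sq_nonneg _
    linarith
  have h6 : (fun x => v x ^ 2) =ᵐ[volume.restrict (Icc 0 1)] 0 :=
    (integral_eq_zero_iff_of_nonneg (fun x => sq_nonneg _) hv.integrable_sq).1
      (le_antisymm hvsq (integral_nonneg fun x => sq_nonneg _))
  filter_upwards [h6] with x hx
  exact pow_eq_zero_iff two_ne_zero |>.1 hx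

/-! ### Completeness of the tensor products -/

/-- A square integrable function on `(0, 2π]` whose trigonometric moments vanish is zero. -/
theorem integral_sq_eq_zero_of_trig {h : ℝ → ℝ}
    (hh : MemLp h 2 (volume.restrict (Ioc 0 (2 * Real.pi))))
    (H : ∀ (m : ℕ) (c : ℝ), ∫ θ in Ioc 0 (2 * Real.pi), h θ * trigChain m c 0 θ = 0) :
    ∫ θ in Ioc 0 (2 * Real.pi), h θ ^ 2 = 0 := by
  have hpi : (0 : ℝ) < 2 * Real.pi := by positivity
  have hcos : ∀ (n : ℤ) (c : ℝ), ∫ θ in Ioc 0 (2 * Real.pi), h θ * Real.cos (n * θ + c) = 0 := by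
    intro n c
    obtain ⟨m, rfl | rfl⟩ := Int.eq_nat_or_neg n
    · simpa [trigChain] using H m c
    · have h1 := H m (-c)
      simp only [trigChain, pow_zero, one_mul, Nat.cast_zero, zero_mul, add_zero] at h1
      refine Eq.trans ?_ h1
      congr 1
      ext θ
      rw [← Real.cos_neg ((m : ℝ) * θ + -c)]
      congr 2
      push_cast
      ring
  have hint : ∀ (n : ℤ) (c : ℝ), Integrable (fun θ => h θ * Real.cos (n * θ + c))
      (volume.restrict (Ioc 0 (2 * Real.pi))) := fun n c =>
    (hh.integrable one_le_two).mul_bdd (c := 1) (by fun_prop)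
      (ae_of_all _ fun θ => Real.abs_cos_le_one _)
  have hcoef : ∀ n : ℤ, fourierCoeffOn hpi (fun θ => (h θ : ℂ)) n = 0 := by
    intro n
    rw [fourierCoeffOn_eq_integral, intervalIntegral.integral_of_le hpi.le]
    have e : ∀ θ : ℝ, fourier (-n) (θ : AddCircle (2 * Real.pi - 0)) • (h θ : ℂ) =
        ((h θ * Real.cos (n * θ + 0) : ℝ) : ℂ) +
          Complex.I * ((h θ * Real.cos (n * θ + Real.pi / 2) : ℝ) : ℂ) := by
      intro θ
      have hpi' : (Real.pi : ℂ) ≠ 0 := by exact_mod_cast Real.pi_ne_zero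
      rw [fourier_coe_apply, Real.cos_add_pi_div_two, smul_eq_mul, sub_zero, add_zero,
        show 2 * (Real.pi : ℂ) * Complex.I * ((-n : ℤ) : ℂ) * θ / ((2 * Real.pi : ℝ) : ℂ) =
          ((-(n * θ) : ℝ) : ℂ) * Complex.I by push_cast; field_simp,
        Complex.exp_mul_I, ← Complex.ofReal_cos, ← Complex.ofReal_sin, Real.cos_neg, Real.sin_neg]
      push_cast
      ring
    simp only [e]
    rw [integral_add (hint n 0).ofReal ((hint n _).ofReal.const_mul _), integral_const_mul,
      integral_complex_ofReal, integral_complex_ofReal, hcos, hcos]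
    simp
  have hL : MemLp (fun θ => (h θ : ℂ)) 2 (volume.restrict (Ioc 0 (2 * Real.pi))) := hh.ofReal
  have hP := tsum_sq_fourierCoeffOn hpi hL
  simp only [hcoef, norm_zero, Complex.norm_real, Real.norm_eq_abs, sq_abs, ne_eq,
    OfNat.ofNat_ne_zero, not_false_eq_true, zero_pow, tsum_zero, sub_zero] at hP
  rw [intervalIntegral.integral_of_le hpi.le, smul_eq_mul, eq_comm, mul_eq_zero] at hP
  exact hP.resolve_left (inv_ne_zero hpi.ne')

/-- The moments in the angle of a function on the cylinder against `g`, as a function of `t`. -/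
noncomputable def angularMoment (U : ℝ × ℝ → ℝ) (g : ℝ → ℝ) (t : ℝ) : ℝ :=
  ∫ θ in Ioc 0 (2 * Real.pi), U (t, θ) * g θ

theorem memLp_mul_angular {U : ℝ × ℝ → ℝ} (hU : MemLp U 2 cylMeasure) {g : ℝ → ℝ}
    (hg : Continuous g) : MemLp (fun p => U p * g p.2) 2 cylMeasure := by
  obtain ⟨C, hC⟩ := ae_bound_tensor (f := fun _ => 1) (fun _ => ⟨1, fun _ _ => by simp⟩)
    (exists_bound_of_continuous hg)
  simp only [one_mul] at hC
  have hm : AEStronglyMeasurable (fun p : ℝ × ℝ => g p.2) cylMeasure :=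
    (hg.comp continuous_snd).aestronglyMeasurable
  exact (hU.mul (r := 2) (MemLp.of_bound hm C hC : MemLp _ ∞ cylMeasure) :)
    |>.ae_eq (ae_of_all _ fun p => mul_comm _ _)

theorem ae_memLp_slice {U : ℝ × ℝ → ℝ} (hU : MemLp U 2 cylMeasure) :
    ∀ᵐ t ∂(volume.restrict (Icc (0 : ℝ) 1)),
      MemLp (fun θ => U (t, θ)) 2 (volume.restrict (Ioc 0 (2 * Real.pi))) := by
  have h1 : Integrable (fun p => U p ^ 2) cylMeasure := hU.integrable_sq
  have h2 := hU.aestronglyMeasurable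
  unfold cylMeasure at h1 h2
  filter_upwards [h1.prod_right_ae, h2.prodMk_left] with t h3 h4
  exact (memLp_two_iff_integrable_sq h4).2 h3

theorem memLp_angularMoment {U : ℝ × ℝ → ℝ} (hU : MemLp U 2 cylMeasure) {g : ℝ → ℝ}
    (hg : Continuous g) : MemLp (angularMoment U g) 2 (volume.restrict (Icc 0 1)) := by
  have hUg := memLp_mul_angular hU hg
  have h1 : Integrable (fun p => U p * g p.2) cylMeasure := hUg.integrable one_le_two
  have h2 : Integrable (fun p => (U p * g p.2) ^ 2) cylMeasure := hUg.integrable_sq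
  have hs := ae_memLp_slice hUg
  unfold cylMeasure at h1 h2
  have hm : AEStronglyMeasurable (angularMoment U g) (volume.restrict (Icc 0 1)) :=
    h1.integral_prod_left.aestronglyMeasurable
  rw [memLp_two_iff_integrable_sq hm]
  refine (h2.integral_prod_left.const_mul
    ((volume.restrict (Ioc 0 (2 * Real.pi))).real univ)).mono' (hm.pow 2) ?_
  filter_upwards [hs] with t ht
  rw [Real.norm_eq_abs, abs_of_nonneg (sq_nonneg _)]
  exact sq_integral_le_measure_mul ht

theorem integral_mul_tensor {U : ℝ × ℝ → ℝ} (hU : MemLp U 2 cylMeasure) {f g : ℝ → ℝ}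
    (hf : Continuous f) (hg : Continuous g) :
    ∫ p, U p * (f p.1 * g p.2) ∂cylMeasure = ∫ t in Icc 0 1, angularMoment U g t * f t := by
  have h1 : Integrable (fun p => U p * (f p.1 * g p.2)) cylMeasure :=
    hU.integrable_mul (memLp_cyl_of_continuous (φ := fun p => f p.1 * g p.2) (by fun_prop))
  unfold cylMeasure at h1 ⊢
  rw [integral_prod _ h1]
  congr 1
  ext t
  rw [angularMoment, ← integral_mul_const]
  congr 1
  ext θ
  ring

theorem ae_eq_zero_of_angularMoment {U : ℝ × ℝ → ℝ} (hU : MemLp U 2 cylMeasure)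
    (H : ∀ m c, angularMoment U (trigChain m c 0) =ᵐ[volume.restrict (Icc 0 1)] 0) :
    U =ᵐ[cylMeasure] 0 := by
  have h2 : Integrable (fun p => U p ^ 2) cylMeasure := hU.integrable_sq
  have hall : ∀ᵐ t ∂(volume.restrict (Icc (0 : ℝ) 1)), ∀ (m : ℕ) (b : Bool),
      angularMoment U (trigChain m (if b then 0 else Real.pi / 2) 0) t = 0 :=
    ae_all_iff.2 fun m => ae_all_iff.2 fun b => H m _
  have h0 : ∫ p, U p ^ 2 ∂cylMeasure = 0 := by
    have h2' := h2
    unfold cylMeasure at h2' ⊢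
    rw [integral_prod _ h2']
    refine integral_eq_zero_of_ae ?_
    filter_upwards [hall, ae_memLp_slice hU] with t ht hUt
    refine integral_sq_eq_zero_of_trig hUt fun m c => ?_
    have i1 : ∀ c, Integrable (fun θ => U (t, θ) * trigChain m c 0 θ)
        (volume.restrict (Ioc 0 (2 * Real.pi))) := fun c =>
      (hUt.integrable one_le_two).mul_bdd (c := 1)
        ((derivChain_trigChain m c).continuous 0).aestronglyMeasurable
        (ae_of_all _ fun θ => by simpa [trigChain] using Real.abs_cos_le_one _)
    -- every phase is a combination of the phases `0` and `π / 2`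
    have e : ∀ θ, U (t, θ) * trigChain m c 0 θ = Real.cos c * (U (t, θ) * trigChain m 0 0 θ) +
        Real.sin c * (U (t, θ) * trigChain m (Real.pi / 2) 0 θ) := by
      intro θ
      simp only [trigChain, pow_zero, one_mul, Nat.cast_zero, zero_mul, add_zero]
      rw [Real.cos_add_pi_div_two, Real.cos_add]
      ring
    have t1 : ∫ θ in Ioc 0 (2 * Real.pi), U (t, θ) * trigChain m 0 0 θ = 0 := by
      simpa [angularMoment] using ht m true
    have t2 : ∫ θ in Ioc 0 (2 * Real.pi), U (t, θ) * trigChain m (Real.pi / 2) 0 θ = 0 := by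
      simpa [angularMoment] using ht m false
    simp only [e]
    rw [integral_add ((i1 _).const_mul _) ((i1 _).const_mul _), integral_const_mul,
      integral_const_mul, t1, t2, mul_zero, mul_zero, add_zero]
  filter_upwards [(integral_eq_zero_iff_of_nonneg (fun p => sq_nonneg (U p)) h2).1 h0] with p hp
  exact (pow_eq_zero_iff two_ne_zero).1 hp

theorem contDiff_trigChain (m : ℕ) (c : ℝ) (i : ℕ) : ContDiff ℝ ∞ (trigChain m c i) := by
  unfold trigChain
  fun_prop

theorem isTestFunction_tensor {φ : ℝ → ℝ} (hφ : IsIntervalTestFunction φ) (m : ℕ) (c : ℝ) (i : ℕ) :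
    IsTestFunction fun p => φ p.1 * trigChain m c i p.2 where
  smooth := (hφ.smooth.comp contDiff_fst).mul ((contDiff_trigChain m c i).comp contDiff_snd)
  periodic t θ := by simp only [trigChain_add_period]
  compactSupport := by
    obtain ⟨ε, hε, H⟩ := hφ.compactSupport
    exact ⟨ε, hε, fun t θ h => H t (left_ne_zero_of_mul h)⟩

theorem mixedPartial_tensor {φ : ℝ → ℝ} (hφ : IsIntervalTestFunction φ) (m : ℕ) (c : ℝ)
    (i a b : ℕ) : mixedPartial a b (fun p => φ p.1 * trigChain m c i p.2) =
      fun p => iteratedDeriv a φ p.1 * trigChain m c (i + b) p.2 := by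
  have hΘ : partialTheta^[b] (fun p => φ p.1 * trigChain m c i p.2) =
      fun p => φ p.1 * trigChain m c (i + b) p.2 := by
    induction b with
    | zero => rfl
    | succ b ih =>
      rw [Function.iterate_succ_apply', ih]
      ext ⟨t, θ⟩
      exact (hasDerivAt_partialTheta (isTestFunction_tensor hφ m c (i + b)).smooth t θ).unique
        ((derivChain_trigChain m c (i + b) θ).const_mul (φ t))
  rw [mixedPartial, hΘ]
  induction a with
  | zero => simp
  | succ a ih =>
    rw [Function.iterate_succ_apply', ih]
    ext ⟨t, θ⟩
    have h1 := ((hφ.iteratedDeriv a).hasDerivAt t).mul_const (trigChain m c (i + b) θ)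
    rw [iteratedDeriv_succ]
    exact (hasDerivAt_partialT
      (isTestFunction_tensor (hφ.iteratedDeriv a) m c (i + b)).smooth t θ).unique h1

theorem trigChain_add_self (m : ℕ) (c : ℝ) (ℓ : ℕ) (θ : ℝ) :
    trigChain m c (ℓ + ℓ) θ = (-1) ^ ℓ * ((m : ℝ) ^ (ℓ + ℓ) * trigChain m c 0 θ) := by
  unfold trigChain
  rw [show (m * θ + c + ((ℓ + ℓ : ℕ) : ℝ) * (Real.pi / 2)) = m * θ + c + ℓ * Real.pi by
    push_cast; ring, Real.cos_add_nat_mul_pi]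
  simp only [pow_zero, one_mul, Nat.cast_zero, zero_mul, add_zero]
  ring

/-- `W` is the weak derivative `∂ₜᵃ ∂_θᵇ U` of the real function `U` on the cylinder. -/
def HasScalarWeakDeriv (a b : ℕ) (U W : ℝ × ℝ → ℝ) : Prop :=
  ∀ φ : ℝ × ℝ → ℝ, IsTestFunction φ →
    ∫ p, U p * mixedPartial a b φ p ∂cylMeasure = (-1) ^ (a + b) * ∫ p, W p * φ p ∂cylMeasure

theorem HasScalarWeakDeriv.integral_angularMoment {a b : ℕ} {U W : ℝ × ℝ → ℝ}
    (h : HasScalarWeakDeriv a b U W) (hU : MemLp U 2 cylMeasure) (hW : MemLp W 2 cylMeasure)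
    {φ : ℝ → ℝ} (hφ : IsIntervalTestFunction φ) (m : ℕ) (c : ℝ) (i : ℕ) :
    ∫ t in Icc 0 1, angularMoment U (trigChain m c (i + b)) t * iteratedDeriv a φ t =
      (-1) ^ (a + b) * ∫ t in Icc 0 1, angularMoment W (trigChain m c i) t * φ t := by
  have h1 := h _ (isTestFunction_tensor hφ m c i)
  rw [mixedPartial_tensor hφ] at h1
  rwa [integral_mul_tensor hU (hφ.iteratedDeriv a).smooth.continuous
    (contDiff_trigChain m c _).continuous, integral_mul_tensor hW hφ.smooth.continuous
    (contDiff_trigChain m c _).continuous] at h1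

theorem integrableOn_angularMoment {U : ℝ × ℝ → ℝ} (hU : MemLp U 2 cylMeasure) (m : ℕ) (c : ℝ)
    (i : ℕ) : IntegrableOn (angularMoment U (trigChain m c i)) (Icc 0 1) :=
  (memLp_angularMoment hU (contDiff_trigChain m c _).continuous).integrable one_le_two

/-- Weak derivatives of zero vanish. -/
theorem HasScalarWeakDeriv.ae_eq_zero {a b : ℕ} {U W : ℝ × ℝ → ℝ}
    (h : HasScalarWeakDeriv a b U W) (hW : MemLp W 2 cylMeasure) (h0 : U =ᵐ[cylMeasure] 0) :
    W =ᵐ[cylMeasure] 0 := by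
  refine ae_eq_zero_of_angularMoment hW fun m c => ?_
  refine ae_eq_zero_of_forall_integral_test (integrableOn_angularMoment hW m c 0) fun φ hφ => ?_
  have h1 := h _ (isTestFunction_tensor hφ m c 0)
  have h2 : ∫ p, U p * mixedPartial a b (fun p => φ p.1 * trigChain m c 0 p.2) p ∂cylMeasure = 0 :=
    integral_eq_zero_of_ae (by filter_upwards [h0] with p hp; simp [hp])
  rw [h2, integral_mul_tensor hW hφ.smooth.continuous
    (contDiff_trigChain m c _).continuous, eq_comm, mul_eq_zero] at h1
  simp only [mul_comm (φ _)]
  exact h1.resolve_left (pow_ne_zero _ (by norm_num))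

/-- On trigonometric functions of frequency `m`, integrating a weak `θ`-derivative of order `ℓ`
against an `ℓ`-th derivative amounts to multiplication by `m ^ (2 ℓ)`. -/
theorem angularMoment_weakDeriv_ae_eq {a ℓ : ℕ} {U V W : ℝ × ℝ → ℝ}
    (hV : HasScalarWeakDeriv a 0 U V) (hW : HasScalarWeakDeriv a ℓ U W)
    (hUL : MemLp U 2 cylMeasure) (hVL : MemLp V 2 cylMeasure) (hWL : MemLp W 2 cylMeasure)
    (m : ℕ) (c : ℝ) :
    angularMoment W (trigChain m c ℓ) =ᵐ[volume.restrict (Icc 0 1)]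
      fun t => (m : ℝ) ^ (ℓ + ℓ) * angularMoment V (trigChain m c 0) t := by
  have hVi := integrableOn_angularMoment hVL m c 0
  have hWi := integrableOn_angularMoment hWL m c ℓ
  have key := ae_eq_zero_of_forall_integral_test
    (hWi.sub (hVi.const_mul ((m : ℝ) ^ (ℓ + ℓ)))) fun φ hφ => by
      have h1 := hV.integral_angularMoment hUL hVL hφ m c 0
      have h2 := hW.integral_angularMoment hUL hWL hφ m c ℓ
      have e : ∀ t, angularMoment U (trigChain m c (ℓ + ℓ)) t =
          (-1) ^ ℓ * (m : ℝ) ^ (ℓ + ℓ) * angularMoment U (trigChain m c 0) t := by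
        intro t
        rw [angularMoment, angularMoment, ← integral_const_mul]
        congr 1
        ext θ
        rw [trigChain_add_self]
        ring
      simp only [e, mul_assoc] at h2
      rw [integral_const_mul, integral_const_mul] at h2
      rw [add_zero, add_zero] at h1
      rw [h1, pow_add (-1 : ℝ) a ℓ] at h2
      simp only [Pi.sub_apply, mul_sub]
      rw [integral_sub (hφ.integrableOn_mul hWi) (hφ.integrableOn_mul (hVi.const_mul _))]
      simp only [mul_left_comm (φ _), mul_comm (φ _)]
      rw [integral_const_mul, sub_eq_zero]
      have h3 : ((-1 : ℝ) ^ ℓ * (-1) ^ a) ≠ 0 := by positivity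
      refine mul_left_cancel₀ h3 ?_
      linear_combination -h2
  filter_upwards [key] with t ht
  exact sub_eq_zero.1 ht

/-- A real function in `H^{k,ℓ}` which is orthogonal to all products of polynomials in `t` and
trigonometric functions in `θ` vanishes. -/
theorem ae_eq_zero_of_orthogonal_tensor {k ℓ : ℕ} {U : Fin 2 → Fin 2 → ℝ × ℝ → ℝ}
    (hU : ∀ a b, MemLp (U a b) 2 cylMeasure)
    (hweak : ∀ a b : Fin 2, HasScalarWeakDeriv (a * k) (b * ℓ) (U 0 0) (U a b))
    (horth : ∀ q m c, ∑ a : Fin 2, ∑ b : Fin 2, ∫ p, U a b p *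
      (polyChain q (a * k) p.1 * trigChain m c (b * ℓ) p.2) ∂cylMeasure = 0) :
    U 0 0 =ᵐ[cylMeasure] 0 := by
  refine ae_eq_zero_of_angularMoment (hU 0 0) fun m c => ?_
  have htc := (derivChain_trigChain m c).continuous
  have hw00 : HasScalarWeakDeriv 0 0 (U 0 0) (U 0 0) := by simpa using hweak 0 0
  have hw10 : HasScalarWeakDeriv k 0 (U 0 0) (U 1 0) := by simpa using hweak 1 0
  have hw01 : HasScalarWeakDeriv 0 ℓ (U 0 0) (U 0 1) := by simpa using hweak 0 1
  have hw11 : HasScalarWeakDeriv k ℓ (U 0 0) (U 1 1) := by simpa using hweak 1 1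
  have h01 := angularMoment_weakDeriv_ae_eq hw00 hw01 (hU 0 0) (hU 0 0) (hU 0 1) m c
  have h11 := angularMoment_weakDeriv_ae_eq hw10 hw11 (hU 0 0) (hU 1 0) (hU 1 1) m c
  refine ae_eq_zero_of_orthogonal_polynomials k (memLp_angularMoment (hU 0 0) (htc 0))
    (memLp_angularMoment (hU 1 0) (htc 0)) (fun φ hφ => ?_) fun q => ?_
  · have := hw10.integral_angularMoment (hU 0 0) (hU 1 0) hφ m c 0
    simpa only [mul_comm, add_zero] using this
  · have h1 := horth q m c
    have hq := (derivChain_polyChain q).continuous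
    simp only [Fin.sum_univ_two, Fin.val_zero, Fin.val_one, zero_mul, one_mul] at h1
    rw [integral_mul_tensor (hU 0 0) (hq _) (htc _), integral_mul_tensor (hU 0 1) (hq _) (htc _),
      integral_mul_tensor (hU 1 0) (hq _) (htc _), integral_mul_tensor (hU 1 1) (hq _) (htc _)] at h1
    have e0 : ∫ t in Icc 0 1, angularMoment (U 0 1) (trigChain m c ℓ) t * polyChain q 0 t =
        (m : ℝ) ^ (ℓ + ℓ) *
          ∫ t in Icc 0 1, angularMoment (U 0 0) (trigChain m c 0) t * polyChain q 0 t := by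
      rw [← integral_const_mul]
      refine integral_congr_ae ?_
      filter_upwards [h01] with t ht
      rw [ht, mul_assoc]
    have e1 : ∫ t in Icc 0 1, angularMoment (U 1 1) (trigChain m c ℓ) t * polyChain q k t =
        (m : ℝ) ^ (ℓ + ℓ) *
          ∫ t in Icc 0 1, angularMoment (U 1 0) (trigChain m c 0) t * polyChain q k t := by
      rw [← integral_const_mul]
      refine integral_congr_ae ?_
      filter_upwards [h11] with t ht
      rw [ht, mul_assoc]
    rw [e0, e1] at h1
    have hpos : (1 + (m : ℝ) ^ (ℓ + ℓ)) ≠ 0 := by positivity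
    refine mul_left_cancel₀ hpos ?_
    linear_combination h1

section

variable {E : Type*} [NormedAddCommGroup E] [InnerProductSpace ℝ E] [FiniteDimensional ℝ E]

theorem HasWeakDeriv.hasScalarWeakDeriv {a b : ℕ} {f g : CylL2 E} (h : HasWeakDeriv a b f g)
    (e : E) : HasScalarWeakDeriv a b (fun p => inner ℝ e (f p)) fun p => inner ℝ e (g p) := by
  have : CompleteSpace E := FiniteDimensional.complete ℝ E
  intro φ hφ
  have hi : ∀ {ψ : ℝ × ℝ → ℝ} (f : CylL2 E), Continuous ψ →
      ∫ p, inner ℝ e (f p) * ψ p ∂cylMeasure = inner ℝ e (∫ p, ψ p • f p ∂cylMeasure) := by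
    intro ψ f hψ
    have hint : Integrable (fun p => ψ p • f p) cylMeasure :=
      memLp_one_iff_integrable.1 ((Lp.memLp f).smul (memLp_cyl_of_continuous hψ))
    rw [← integral_inner hint]
    simp only [real_inner_smul_right, mul_comm]
  rw [hi f (contDiff_mixedPartial a b hφ.smooth).continuous, hi g hφ.smooth.continuous, h φ hφ,
    real_inner_smul_right]

/-- The products of polynomials in `t` and trigonometric functions in `θ`, with values in a line. -/
def polyTrigTensors (E : Type*) [NormedAddCommGroup E] [InnerProductSpace ℝ E]
    [FiniteDimensional ℝ E] (k ℓ : ℕ) : Set (MixedSobolev E k ℓ) :=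
  {u | ∃ (q : Polynomial ℝ) (m : ℕ) (c : ℝ) (e : E), ∀ a b : Fin 2,
    (u : PiLp 2 fun _ : Fin 2 × Fin 2 => CylL2 E) (a, b) =ᵐ[cylMeasure]
      fun p => (polyChain q (a * k) p.1 * trigChain m c (b * ℓ) p.2) • e}

theorem eq_zero_of_orthogonal_polyTrigTensors {k ℓ : ℕ} {u : MixedSobolev E k ℓ}
    (hu : ∀ v ∈ polyTrigTensors E k ℓ, inner ℝ v u = 0) : u = 0 := by
  have : CompleteSpace E := FiniteDimensional.complete ℝ E
  let f : Fin 2 × Fin 2 → CylL2 E := fun q => (u : PiLp 2 fun _ : Fin 2 × Fin 2 => CylL2 E) q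
  have hweak : ∀ (e : E) (a b : Fin 2), HasScalarWeakDeriv (a * k) (b * ℓ)
      (fun p => inner ℝ e (f (0, 0) p)) fun p => inner ℝ e (f (a, b) p) :=
    fun e a b => (u.2 a b).hasScalarWeakDeriv e
  have hL : ∀ (e : E) (a b : Fin 2), MemLp (fun p => inner ℝ e (f (a, b) p)) 2 cylMeasure :=
    fun e a b => (Lp.memLp (f (a, b))).const_inner e
  have h00 : ∀ e : E, (fun p => inner ℝ e (f (0, 0) p)) =ᵐ[cylMeasure] 0 := by
    intro e
    refine ae_eq_zero_of_orthogonal_tensor (U := fun a b p => inner ℝ e (f (a, b) p)) (hL e)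
      (hweak e) fun q m c => ?_
    obtain ⟨v, hv⟩ := exists_mixedSobolev_tensor (E := E)
      ((derivChain_polyChain q).rightDerivChain k) ((derivChain_trigChain m c).rightDerivChain ℓ)
      (trigChain_add_period m c) e
    have h1 := hu v ⟨q, m, c, e, hv⟩
    rw [Submodule.coe_inner, PiLp.inner_apply, Fintype.sum_prod_type] at h1
    rw [← h1]
    refine Finset.sum_congr rfl fun a _ => Finset.sum_congr rfl fun b _ => ?_
    rw [L2.inner_def]
    refine integral_congr_ae ?_
    filter_upwards [hv a b] with p hp
    rw [hp, real_inner_smul_left, mul_comm]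
  have hab : ∀ a b : Fin 2, f (a, b) = 0 := by
    intro a b
    have h1 : ∀ᵐ p ∂cylMeasure, ∀ i, inner ℝ (stdOrthonormalBasis ℝ E i) (f (a, b) p) = 0 :=
      ae_all_iff.2 fun i => (hweak _ a b).ae_eq_zero (hL _ a b) (h00 _)
    refine (Lp.eq_zero_iff_ae_eq_zero).2 ?_
    filter_upwards [h1] with p hp
    have h2 := (stdOrthonormalBasis ℝ E).sum_repr' (f (a, b) p)
    simpa [hp] using h2.symm
  ext1
  ext1 q
  exact hab q.1 q.2

end

theorem lemma3p1 {E : Type*} [NormedAddCommGroup E] [InnerProductSpace ℝ E]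
    [FiniteDimensional ℝ E] (k ℓ nt nθ : ℕ) (hk : k ≤ nt) (hℓ : ℓ ≤ nθ)
    (c : MixedSobolev E k ℓ) :
    Tendsto (fun N : ℕ × ℕ => ‖c - splineProj E k ℓ nt nθ N.1 N.2 c‖) atTop (𝓝 0) := by
  refine tendsto_splineProj_of_dense (T := polyTrigTensors E k ℓ) ?_
    (fun u hu => eq_zero_of_orthogonal_polyTrigTensors hu) c
  rintro u ⟨q, m, γ, e, hu⟩
  exact tendsto_splineProj_tensor hk hℓ (derivChain_polyChain q) (derivChain_trigChain m γ)
    (trigChain_add_period m γ 0) e hu
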